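/- Let $\alpha>0$, $\lambda>0$ and $H=\tfrac12+\alpha$. Let $\{Z_j\}_{j\in\mathbb Z}$ be i.i.d. real random variables with mean zero and finite variance $\sigma^2$. For $n\ge 1$ put $$C_j^{\lambda/n}=\frac{1}{\Gamma(\alpha)}\,j^{\alpha-1}e^{-\lambda j/n}\ (j\ge 1),\qquad C_j^{\lambda/n}=0\ (j\le 0),\qquad Y_k^{\lambda/n}=\sum_{j\in\mathbb Z}C_j^{\lambda/n}Z_{k-j},$$ and let $$S_n(t)=\sum_{k=1}^{[t]}Y_k^{\lambda/n}+(t-[t])\,Y_{[t]+1}^{\lambda/n},\qquad t\ge 0,$$ be the interpolated partial sums, where $[t]$ is the integer part of $t$. Let $B(dy)$ be an independently scattered Gaussian random measure on $\mathbb R$ with control measure $\sigma^2\,dy$, and let $$Z^1_{H,\lambda}(t)=\int_{\mathbb R}\Big(\int_0^t (s-y)_+^{H-\frac32}e^{-\lambda(s-y)_+}\,ds\Big)B(dy),\qquad 0\le t\le 1,$$ be the tempered Hermite process of order one, where $(x)_+^{p}=x^p$ for $x>0$ and $(x)_+^{p}=0$ for $x\le 0$. Then the following hold. (i) For all $n\ge1$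 and $k\in\mathbb Z$ the series that defines $Y_k^{\lambda/n}$ converges absolutely almost surely. (ii) $Z^1_{H,\lambda}$ has a version with continuous paths on $[0,1]$, and, for this version, $$n^{-H}S_n(nt)\ \Rightarrow\ \frac{1}{\Gamma(\alpha)}\,Z^1_{H,\lambda}(t)\qquad (n\to\infty)$$ weakly in $C[0,1]$, the space of continuous functions on $[0,1]$ with the supremum norm. (iii) If $\tfrac12<H<1$, there is a constant $C$ such that for all $n\ge1$ and all $t_1,t_2\in[0,1]$ $$\mathbb E\Big[\big|n^{-H}S_n(nt_2)-n^{-H}S_n(nt_1)\big|^2\Big]\le C\,|t_2-t_1|^{2H}.$$ -/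

import Mathlib

open MeasureTheory ProbabilityTheory Filter Topology
open scoped NNReal ENNReal

/-! ### The space `C[0,1]` with its Borel σ-algebra -/

/-- The space of continuous real functions on `[0,1]`, with the supremum metric, carries its Borel
σ-algebra. -/
instance continuousMapUnitIntervalMeasurableSpace : MeasurableSpace C(unitInterval, ℝ) :=
  borel C(unitInterval, ℝ)

instance continuousMapUnitIntervalBorelSpace : BorelSpace C(unitInterval, ℝ) := ⟨rfl⟩

namespace TemperedHermite

/-! ### Tempered linear processes and their interpolated partial sums -/

section Discrete

/-- The coefficients `C_j^μ = j^(α-1) e^(-μ j) / Γ(α)` for `j ≥ 1`, and `C_j^μ = 0` for `j ≤ 0`;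
`μ` is the tempering parameter. -/
noncomputable def coeff (α μ : ℝ) (j : ℤ) : ℝ :=
  if 1 ≤ j then (1 / Real.Gamma α) * (j : ℝ) ^ (α - 1) * Real.exp (-(μ * (j : ℝ))) else 0

/-- The tempered linear process `Y_k^μ = ∑_{j ∈ ℤ} C_j^μ Z_{k-j}`. -/
noncomputable def linearProcess {Ω : Type*} (α μ : ℝ) (Z : ℤ → Ω → ℝ) (k : ℤ) (ω : Ω) : ℝ :=
  ∑' j : ℤ, coeff α μ j * Z (k - j) ω

/-- The interpolated partial sums `∑_{k=1}^{[t]} y_k + (t - [t]) y_{[t]+1}`, for `t ≥ 0`. -/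
noncomputable def partialSum (y : ℕ → ℝ) (t : ℝ) : ℝ :=
  ∑ k ∈ Finset.Icc 1 ⌊t⌋₊, y k + (t - (⌊t⌋₊ : ℝ)) * y (⌊t⌋₊ + 1)

theorem partialSum_eq (y : ℕ → ℝ) (N : ℕ) {t : ℝ} (h0 : 0 ≤ t) (hN : t ≤ N) :
    partialSum y t = ∑ k ∈ Finset.range N, max 0 (min 1 (t - k)) * y (k + 1) := by
  have hf : (⌊t⌋₊ : ℝ) ≤ t := Nat.floor_le h0
  have hf' : t < (⌊t⌋₊ : ℝ) + 1 := Nat.lt_floor_add_one t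
  have hmN : ⌊t⌋₊ ≤ N := by exact_mod_cast hf.trans hN
  have hpart : ∑ k ∈ Finset.Icc 1 ⌊t⌋₊, y k =
      ∑ k ∈ Finset.range ⌊t⌋₊, max 0 (min 1 (t - k)) * y (k + 1) := by
    rw [Finset.range_eq_Ico, ← Finset.Ico_add_one_right_eq_Icc,
      ← Finset.sum_Ico_add' y 0 ⌊t⌋₊ 1]
    refine Finset.sum_congr rfl fun k hk => ?_
    have hk' : k + 1 ≤ ⌊t⌋₊ := (Finset.mem_Ico.1 hk).2
    have hk'' : (k : ℝ) + 1 ≤ ⌊t⌋₊ := by exact_mod_cast hk'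
    rw [min_eq_left (by linarith), max_eq_right zero_le_one, one_mul]
  have hzero : ∀ k : ℕ, ⌊t⌋₊ + 1 ≤ k → max 0 (min 1 (t - k)) * y (k + 1) = 0 := by
    intro k hk
    have hk' : (⌊t⌋₊ : ℝ) + 1 ≤ k := by exact_mod_cast hk
    rw [max_eq_left ((min_le_right _ _).trans (by linarith)), zero_mul]
  rw [partialSum, hpart]
  rcases hmN.eq_or_lt with h | h
  · have : t = (⌊t⌋₊ : ℝ) := le_antisymm (hN.trans (by rw [h])) hf
    rw [← this, sub_self, zero_mul, add_zero, h]
  · rw [← Finset.sum_subset (Finset.range_mono h)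
      (fun k _ hk => hzero k (by simpa using hk)), Finset.sum_range_succ,
      min_eq_right (by linarith), max_eq_right (by linarith)]

/-- The path `t ↦ n^(-H) S(nt)`, `0 ≤ t ≤ 1`, where `S` are the interpolated partial sums of
`Y_1, Y_2, …`, as an element of `C[0,1]`. -/
noncomputable def scaledPath (H : ℝ) (n : ℕ) (y : ℕ → ℝ) : C(unitInterval, ℝ) where
  toFun t := (n : ℝ) ^ (-H) * partialSum y (n * (t : ℝ))
  continuous_toFun := by
    have h : (fun t : unitInterval => (n : ℝ) ^ (-H) * partialSum y (n * (t : ℝ))) =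
        fun t : unitInterval => (n : ℝ) ^ (-H) *
          ∑ k ∈ Finset.range n, max 0 (min 1 ((n : ℝ) * t - k)) * y (k + 1) := by
      funext t
      rw [partialSum_eq y n (mul_nonneg n.cast_nonneg t.2.1)
        (mul_le_of_le_one_right n.cast_nonneg t.2.2)]
    rw [h]
    fun_prop

/-- The random element `n^(-H) S_n^(lam/n)(n t)`, `0 ≤ t ≤ 1`, of `C[0,1]`: the scaled partial sums
of the tempered linear process with tempering parameter `lam / n`. -/
noncomputable def scaledPartialSum {Ω : Type*} (α H lam : ℝ) (Z : ℤ → Ω → ℝ) (n : ℕ) (ω : Ω) :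
    C(unitInterval, ℝ) :=
  scaledPath H n (fun k => linearProcess α (lam / n) Z k ω)

end Discrete

/-! ### Gaussian random measures, Wiener integrals and the tempered Hermite process -/

section Continuous

/-- `B` is an independently scattered Gaussian random measure on `ℝ` with control measure `v dx`:
to Borel sets `A` of finite Lebesgue measure it assigns centred Gaussian random variables `B A` of
variance `v |A|`, independent for disjoint sets, and it is σ-additive in mean square. -/
structure IsGaussianRandomMeasure {Ω : Type*} [MeasurableSpace Ω] (B : Set ℝ → Ω → ℝ) (v : ℝ≥0)
    (P : Measure Ω) : Prop where
  hasLaw : ∀ A : Set ℝ, MeasurableSet A → volume A < ∞ →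
    HasLaw (B A) (gaussianReal 0 (v * (volume A).toNNReal)) P
  indep : ∀ (m : ℕ) (A : Fin m → Set ℝ), (∀ i, MeasurableSet (A i)) → (∀ i, volume (A i) < ∞) →
    Pairwise (fun i j => Disjoint (A i) (A j)) → iIndepFun (fun i => B (A i)) P
  additive : ∀ A : ℕ → Set ℝ, (∀ i, MeasurableSet (A i)) → volume (⋃ i, A i) < ∞ →
    Pairwise (fun i j => Disjoint (A i) (A j)) →
    Tendsto (fun m : ℕ => eLpNorm (fun ω => B (⋃ i, A i) ω - ∑ i ∈ Finset.range m, B (A i) ω) 2 P)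
      atTop (𝓝 0)

/-- The integral `∫ φ dB = ∑_c c B({φ = c})` of a simple function `φ` (with support of finite
Lebesgue measure) against the random measure `B`. -/
noncomputable def simpleIntegral {Ω : Type*} (B : Set ℝ → Ω → ℝ) (φ : SimpleFunc ℝ ℝ) (ω : Ω) :
    ℝ :=
  ∑ c ∈ φ.range, c * B (φ ⁻¹' {c}) ω

/-- `X` is (a version of) the Wiener integral `∫ f dB` of `f ∈ L²(ℝ, dx)`: the limit in `L²(P)` of
the integrals of simple functions that converge to `f` in `L²(ℝ, dx)`. -/
def IsWienerIntegral {Ω : Type*} [MeasurableSpace Ω] (B : Set ℝ → Ω → ℝ) (P : Measure Ω)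
    (f : ℝ → ℝ) (X : Ω → ℝ) : Prop :=
  MemLp f 2 volume ∧ MemLp X 2 P ∧ ∃ φ : ℕ → SimpleFunc ℝ ℝ,
    (∀ m, MemLp (φ m) 2 volume) ∧
    Tendsto (fun m => eLpNorm (fun y => φ m y - f y) 2 volume) atTop (𝓝 0) ∧
    Tendsto (fun m => eLpNorm (fun ω => simpleIntegral B (φ m) ω - X ω) 2 P) atTop (𝓝 0)

/-- The function `x ↦ (x)_+^p e^(-lam (x)_+)`, which vanishes for `x ≤ 0`. -/
noncomputable def temperedPower (p lam x : ℝ) : ℝ :=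
  if 0 < x then x ^ p * Real.exp (-(lam * x)) else 0

/-- The kernel `g_{H,lam,t}(y) = ∫_0^t (s-y)_+^(H-3/2) e^(-lam (s-y)_+) ds`. -/
noncomputable def kernel (H lam t y : ℝ) : ℝ :=
  ∫ s in (0 : ℝ)..t, temperedPower (H - 3 / 2) lam (s - y)

/-- The random element `ζ` of `C[0,1]` is a version with continuous paths of the tempered Hermite
process of order one `Z^1_{H,lam}(t) = ∫ g_{H,lam,t}(y) B(dy)`, `0 ≤ t ≤ 1`. -/
def IsTemperedHermite {Ω : Type*} [MeasurableSpace Ω] (B : Set ℝ → Ω → ℝ) (P : Measure Ω)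
    (H lam : ℝ) (ζ : Ω → C(unitInterval, ℝ)) : Prop :=
  AEMeasurable ζ P ∧
    ∀ t : unitInterval, IsWienerIntegral B P (kernel H lam (t : ℝ)) (fun ω => ζ ω t)

end Continuous

end TemperedHermite

/-! The scaled path is, almost surely, a weighted sum of the innovations with explicit weights. By
homogeneity of the power, and because the tempering parameter is `lam / n`, the weight of `Z j` at
time `t` is exactly `n^(-1/2) / Γ(α)` times the integral over `[0,t]` of the tempered power
evaluated at the grid distance `(⌈n s⌉ - j) / n` (`weight_eq_gridKernel`). The linear interpolation
is precisely what makes this an identity for all `t`, not only for grid points. Sums over `j` of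
squares of such weights thus become squared `L²` norms of step functions of `y`, with `j = ⌈n y⌉`,
and these step functions converge to the kernel of the limit.

Everything rests on one domination (`exists_powerBound`): the exponential factor permits lowering
`α` to any `β ≤ α` with `0 < β ≤ 1`, so the limiting kernel and all grid kernels are bounded by `K
(s-y)_+^(β-1)` with a common `K`. For `β < 1/2` the increments of the integrated power kernel over
an interval of length `h` have squared `L²` norm at most `c h^(1+2β)`
(`lintegral_posPower_increment_le`). This gives the dominating functions for the limits of
variances, and it bounds second moments of increments by `C |t-s|^(1+2β)`, uniformly in `n`. If `H <
1` the choice `β = α` is allowed, which is (iii).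

Finite-dimensional convergence is a Lindeberg argument: the weights are uniformly `O(n^(-1/2))`, so
each factor of the characteristic function may be replaced by a Gaussian one with total error at
most `ε` times the sum of squared weights (`norm_integral_exp_tsum_sub_le`). The limit variance is
that of the corresponding combination of Wiener integrals.

In place of a tightness argument, dyadic polygonal approximations are used. Since the moment
exponent `1+2β` exceeds one, they converge in `L²(P; C[0,1])` at a geometric rate that is uniform in
`n`. Weak convergence in `C[0,1]` is thereby reduced to finitely many coordinates
(`tendstoInDistribution_of_charFun`), and the same chaining produces the continuous version of the
limit (`exists_continuous_version`). -/

namespace TemperedHermite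

/-! ### Polygonal interpolation on the unit interval -/

/-- The ramp `t ↦ (N t - k)` truncated to `[0,1]`. -/
noncomputable def ramp (N k : ℕ) : C(unitInterval, ℝ) :=
  ⟨fun t => max 0 (min 1 ((N : ℝ) * t - k)), by fun_prop⟩

theorem ramp_apply (N k : ℕ) (t : unitInterval) :
    ramp N k t = max 0 (min 1 ((N : ℝ) * t - k)) := rfl

/-- The polygonal path through the points `(k / N, x k)`, `0 ≤ k ≤ N`. -/
noncomputable def polygon (N : ℕ) (x : ℕ → ℝ) : C(unitInterval, ℝ) :=
  ContinuousMap.const _ (x 0) + ∑ k ∈ Finset.range N, (x (k + 1) - x k) • ramp N k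

/-- The point `k / N`, clamped to the unit interval. -/
noncomputable def node (N k : ℕ) : unitInterval :=
  Set.projIcc 0 1 zero_le_one ((k : ℝ) / N)

theorem polygon_apply (N : ℕ) (x : ℕ → ℝ) (t : unitInterval) :
    polygon N x t = x 0 + ∑ k ∈ Finset.range N, (x (k + 1) - x k) * ramp N k t := by
  simp [polygon, ContinuousMap.sum_apply]

/-- Apply `partialSum_eq` to the increments of `x`: the ramp form is the polygon, and the floor form
telescopes. The truncated `k - 1` is harmless because only `k ≥ 1` occurs. -/
theorem polygon_eq_segment (N : ℕ) (x : ℕ → ℝ) (t : unitInterval) :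
    polygon N x t = x ⌊(N : ℝ) * t⌋₊ +
      ((N : ℝ) * t - ⌊(N : ℝ) * t⌋₊) * (x (⌊(N : ℝ) * t⌋₊ + 1) - x ⌊(N : ℝ) * t⌋₊) := by
  have h := partialSum_eq (fun k => x k - x (k - 1)) N (mul_nonneg N.cast_nonneg t.2.1)
    (mul_le_of_le_one_right N.cast_nonneg t.2.2)
  have htel : ∀ m : ℕ, ∑ k ∈ Finset.Icc 1 m, (x k - x (k - 1)) = x m - x 0 := by
    intro m
    induction m with
    | zero => simp
    | succ m ih => rw [Finset.sum_Icc_succ_top (by omega), ih]; simp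
  rw [partialSum, htel] at h
  rw [polygon_apply]
  simp only [ramp_apply, Nat.add_sub_cancel] at h ⊢
  rw [Finset.sum_congr rfl fun k _ => mul_comm (x (k + 1) - x k) _, ← h]
  ring

theorem node_two_mul (N k : ℕ) : node (2 * N) (2 * k) = node N k := by
  unfold node
  congr 1
  push_cast
  exact mul_div_mul_left _ _ two_ne_zero

theorem abs_node_sub_le (N k : ℕ) (t : unitInterval) :
    |(node N k : ℝ) - t| ≤ |(k : ℝ) / N - t| := by
  have h := Set.abs_projIcc_sub_projIcc (zero_le_one (α := ℝ)) (c := (k : ℝ) / N) (d := t)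
  rwa [Set.projIcc_val] at h

theorem abs_node_floor_sub_le {N : ℕ} (hN : 0 < N) (t : unitInterval) :
    |(node N ⌊(N : ℝ) * t⌋₊ : ℝ) - t| ≤ 1 / N ∧ |(node N (⌊(N : ℝ) * t⌋₊ + 1) : ℝ) - t| ≤ 1 / N := by
  have hN' : (0 : ℝ) < N := by exact_mod_cast hN
  have h1 := Nat.floor_le (mul_nonneg N.cast_nonneg t.2.1 : 0 ≤ (N : ℝ) * t)
  have h2 := Nat.lt_floor_add_one ((N : ℝ) * t)
  have key : ∀ k : ℕ, |(k : ℝ) - N * t| ≤ 1 → |(k : ℝ) / N - t| ≤ 1 / N := by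
    intro k hk
    have : (k : ℝ) / N - t = ((k : ℝ) - N * t) / N := by field_simp
    rw [this, abs_div, abs_of_pos hN']
    gcongr
  refine ⟨(abs_node_sub_le _ _ _).trans (key _ ?_), (abs_node_sub_le _ _ _).trans (key _ ?_)⟩
  · rw [abs_le]; constructor <;> linarith
  · push_cast; rw [abs_le]; constructor <;> linarith

theorem abs_node_succ_sub_le {N : ℕ} (k : ℕ) :
    |(node N (k + 1) : ℝ) - node N k| ≤ 1 / N := by
  have h := Set.abs_projIcc_sub_projIcc (zero_le_one (α := ℝ)) (c := ((k + 1 : ℕ) : ℝ) / N)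
    (d := (k : ℝ) / N)
  refine h.trans (le_of_eq ?_)
  rw [← sub_div, abs_of_nonneg (by push_cast; simp)]
  push_cast
  ring

/-- If both neighbouring nodes are within `ε` of `c`, so is the polygonal path. -/
theorem abs_polygon_sub_le (N : ℕ) (x : ℕ → ℝ) (t : unitInterval) (c : ℝ) :
    |polygon N x t - c| ≤ |x ⌊(N : ℝ) * t⌋₊ - c| + |x (⌊(N : ℝ) * t⌋₊ + 1) - c| := by
  have h1 := Nat.floor_le (mul_nonneg N.cast_nonneg t.2.1 : 0 ≤ (N : ℝ) * t)
  have h2 := Nat.lt_floor_add_one ((N : ℝ) * t)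
  rw [polygon_eq_segment]
  set k := ⌊(N : ℝ) * t⌋₊
  set θ := (N : ℝ) * t - k
  have e : x k + θ * (x (k + 1) - x k) - c = (1 - θ) * (x k - c) + θ * (x (k + 1) - c) := by ring
  have h0 : 0 ≤ θ := by simp only [θ]; linarith
  have h1' : θ ≤ 1 := by simp only [θ]; linarith
  rw [e]
  refine (abs_add_le _ _).trans ?_
  rw [abs_mul, abs_mul, abs_of_nonneg h0, abs_of_nonneg (sub_nonneg.2 h1')]
  gcongr
  · exact mul_le_of_le_one_left (abs_nonneg _) (by linarith)
  · exact mul_le_of_le_one_left (abs_nonneg _) h1'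

theorem tendsto_polygon (f : C(unitInterval, ℝ)) :
    Tendsto (fun m : ℕ => polygon (2 ^ m) (fun k => f (node (2 ^ m) k))) atTop (𝓝 f) := by
  rw [Metric.tendsto_atTop]
  intro ε hε
  obtain ⟨δ, hδ, hf⟩ := Metric.uniformContinuous_iff.1
    (CompactSpace.uniformContinuous_of_continuous f.continuous) (ε / 4) (by positivity)
  obtain ⟨m₀, hm₀⟩ := exists_pow_lt_of_lt_one hδ (by norm_num : (1 / 2 : ℝ) < 1)
  refine ⟨m₀, fun m hm => ?_⟩
  rw [ContinuousMap.dist_lt_iff hε]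
  intro t
  have hsmall : (1 : ℝ) / ((2 ^ m : ℕ) : ℝ) < δ := by
    refine lt_of_le_of_lt ?_ hm₀
    push_cast
    rw [← one_div_pow]
    exact pow_le_pow_of_le_one (by norm_num) (by norm_num) hm
  obtain ⟨h1, h2⟩ := abs_node_floor_sub_le (N := 2 ^ m) (by positivity) t
  have e1 := hf (a := node (2 ^ m) _) (b := t) (lt_of_le_of_lt h1 hsmall)
  have e2 := hf (a := node (2 ^ m) _) (b := t) (lt_of_le_of_lt h2 hsmall)
  rw [Real.dist_eq] at e1 e2 ⊢
  refine lt_of_le_of_lt (abs_polygon_sub_le _ _ t (f t)) ?_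
  linarith

/-- The ramp over a cell is the average of the ramps over its two halves, which lets a coarse
polygon be written on the refined grid. -/
theorem clamp_two_mul (u : ℝ) :
    max 0 (min 1 u) = (max 0 (min 1 (2 * u)) + max 0 (min 1 (2 * u - 1))) / 2 := by
  rcases le_total u 0 with h | h
  · rw [max_eq_left (min_le_of_right_le h), max_eq_left (min_le_of_right_le (by linarith)),
      max_eq_left (min_le_of_right_le (by linarith))]
    norm_num
  · rcases le_total u (1 / 2) with h' | h'
    · rw [min_eq_right (by linarith), min_eq_right (by linarith : 2 * u ≤ 1),
        min_eq_right (by linarith : 2 * u - 1 ≤ 1), max_eq_right h, max_eq_right (by linarith),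
        max_eq_left (by linarith : 2 * u - 1 ≤ 0)]
      ring
    · rcases le_total u 1 with h'' | h''
      · rw [min_eq_right h'', min_eq_left (by linarith : 1 ≤ 2 * u),
          min_eq_right (by linarith : 2 * u - 1 ≤ 1), max_eq_right h, max_eq_right (by linarith),
          max_eq_right (by linarith : 0 ≤ 2 * u - 1)]
        ring
      · rw [min_eq_left h'', min_eq_left (by linarith : 1 ≤ 2 * u),
          min_eq_left (by linarith : 1 ≤ 2 * u - 1)]
        norm_num

theorem ramp_mem (N k : ℕ) (t : unitInterval) : 0 ≤ ramp N k t ∧ ramp N k t ≤ 1 :=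
  ⟨le_max_left _ _, max_le zero_le_one (min_le_left _ _)⟩

theorem ramp_succ_le (N k : ℕ) (t : unitInterval) : ramp N (k + 1) t ≤ ramp N k t := by
  simp only [ramp_apply]
  push_cast
  gcongr
  linarith

theorem ramp_eq (N k : ℕ) (t : unitInterval) :
    ramp N k t = (ramp (2 * N) (2 * k) t + ramp (2 * N) (2 * k + 1) t) / 2 := by
  simp only [ramp_apply]
  rw [clamp_two_mul]
  push_cast
  rw [show 2 * ((N : ℝ) * t - k) = 2 * N * t - 2 * k by ring, sub_sub]

theorem sum_range_two_mul {M : Type*} [AddCommMonoid M] (f : ℕ → M) (N : ℕ) :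
    ∑ k ∈ Finset.range (2 * N), f k = ∑ k ∈ Finset.range N, (f (2 * k) + f (2 * k + 1)) := by
  induction N with
  | zero => simp
  | succ N ih =>
    rw [Finset.sum_range_succ, ← ih, show 2 * (N + 1) = 2 * N + 1 + 1 by ring,
      Finset.sum_range_succ, Finset.sum_range_succ, add_assoc]

/-- On each coarse cell the two polygons agree at the endpoints, so they differ by a tent peaking at
the midpoint. Its height is half the difference of the two fine increments. -/
theorem polygon_two_mul_sub (N : ℕ) (x : ℕ → ℝ) (t : unitInterval) :
    polygon (2 * N) x t - polygon N (fun k => x (2 * k)) t =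
      ∑ k ∈ Finset.range N, (ramp (2 * N) (2 * k) t - ramp (2 * N) (2 * k + 1) t) *
        (((x (2 * k + 1) - x (2 * k)) - (x (2 * k + 1 + 1) - x (2 * k + 1))) / 2) := by
  rw [polygon_apply, polygon_apply, sum_range_two_mul, mul_zero, add_sub_add_left_eq_sub,
    ← Finset.sum_sub_distrib]
  refine Finset.sum_congr rfl fun k _ => ?_
  rw [ramp_eq N k t, mul_add, mul_one]
  ring

/-- The tents have values in `[0,1]` and live on different cells. Instead of disjointness of
supports, the proof bounds each square by a drop of the decreasing sequence of ramps, and these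
drops telescope to at most one. -/
theorem sum_tent_sq_le (N : ℕ) (t : unitInterval) :
    ∑ k ∈ Finset.range N, (ramp (2 * N) (2 * k) t - ramp (2 * N) (2 * k + 1) t) ^ 2 ≤ 1 := by
  have h1 : ∀ k, (ramp (2 * N) (2 * k) t - ramp (2 * N) (2 * k + 1) t) ^ 2 ≤
      ramp (2 * N) (2 * k) t - ramp (2 * N) (2 * (k + 1)) t := by
    intro k
    have a := ramp_succ_le (2 * N) (2 * k) t
    have b := ramp_succ_le (2 * N) (2 * k + 1) t
    have c := (ramp_mem (2 * N) (2 * k) t).2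
    have d := (ramp_mem (2 * N) (2 * k + 1) t).1
    rw [mul_add, mul_one]
    rw [add_assoc] at b
    norm_num at b
    nlinarith
  refine (Finset.sum_le_sum fun k _ => h1 k).trans ?_
  rw [Finset.sum_range_sub']
  linarith [(ramp_mem (2 * N) (2 * 0) t).2, (ramp_mem (2 * N) (2 * N) t).1]

/-- Cauchy-Schwarz against the tents. The supremum over `t` is thus controlled by a sum of squares
of increments, whose expectation needs only second moments. -/
theorem norm_polygon_two_mul_sub_sq_le (N : ℕ) (x : ℕ → ℝ) :
    ‖polygon (2 * N) x - polygon N (fun k => x (2 * k))‖ ^ 2 ≤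
      ∑ k ∈ Finset.range (2 * N), (x (k + 1) - x k) ^ 2 := by
  have hnn : 0 ≤ ∑ k ∈ Finset.range (2 * N), (x (k + 1) - x k) ^ 2 :=
    Finset.sum_nonneg fun _ _ => sq_nonneg _
  rw [← Real.le_sqrt (norm_nonneg _) hnn, ContinuousMap.norm_le _ (Real.sqrt_nonneg _)]
  intro t
  refine Real.le_sqrt_of_sq_le ?_
  rw [Real.norm_eq_abs, sq_abs, ContinuousMap.sub_apply, polygon_two_mul_sub]
  refine (Finset.sum_mul_sq_le_sq_mul_sq _ _ _).trans ?_
  refine (mul_le_of_le_one_left (Finset.sum_nonneg fun _ _ => sq_nonneg _)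
    (sum_tent_sq_le N t)).trans ?_
  rw [sum_range_two_mul]
  refine Finset.sum_le_sum fun k _ => ?_
  nlinarith [sq_nonneg (x (2 * k + 1) - x (2 * k)), sq_nonneg (x (2 * k + 1 + 1) - x (2 * k + 1)),
    sq_nonneg ((x (2 * k + 1) - x (2 * k)) + (x (2 * k + 1 + 1) - x (2 * k + 1)))]

/-! ### Chaining along dyadic polygonal approximations -/

section Chaining

variable {Ω : Type*} [MeasurableSpace Ω] {P : Measure Ω}

/-- The interpolation of the process `x` at the dyadic points of level `m`. -/
noncomputable def dyadicPolygon (x : unitInterval → Ω → ℝ) (m : ℕ) (ω : Ω) :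
    C(unitInterval, ℝ) :=
  polygon (2 ^ m) (fun k => x (node (2 ^ m) k) ω)

theorem continuous_polygon (N : ℕ) : Continuous (polygon N) := by
  unfold polygon
  have h0 : Continuous fun c : ℝ => ContinuousMap.const unitInterval c :=
    ContinuousMap.continuous_const'
  have : Continuous fun x : ℕ → ℝ => ContinuousMap.const unitInterval (x 0) :=
    h0.comp (continuous_apply 0)
  fun_prop

theorem aemeasurable_dyadicPolygon {x : unitInterval → Ω → ℝ} (hx : ∀ t, AEMeasurable (x t) P)
    (m : ℕ) : AEMeasurable (dyadicPolygon x m) P :=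
  (continuous_polygon _).measurable.comp_aemeasurable
    (aemeasurable_pi_lambda _ fun k => hx (node (2 ^ m) k))

theorem memLp_smul_const {E : Type*} [NormedAddCommGroup E] [NormedSpace ℝ E] {f : Ω → ℝ}
    {p : ℝ≥0∞} (hf : MemLp f p P) (g : E) : MemLp (fun ω => f ω • g) p P := by
  refine MemLp.of_le_mul (c := ‖g‖) hf
    ((continuous_id.smul continuous_const).comp_aestronglyMeasurable hf.1) ?_
  exact ae_of_all _ fun ω => by rw [norm_smul, mul_comm]

theorem memLp_dyadicPolygon {x : unitInterval → Ω → ℝ} (hx : ∀ t, MemLp (x t) 2 P) (m : ℕ) :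
    MemLp (dyadicPolygon x m) 2 P := by
  have h : dyadicPolygon x m = fun ω => x (node (2 ^ m) 0) ω • (1 : C(unitInterval, ℝ)) +
      ∑ k ∈ Finset.range (2 ^ m), (x (node (2 ^ m) (k + 1)) ω - x (node (2 ^ m) k) ω) •
        ramp (2 ^ m) k := by
    funext ω
    rw [dyadicPolygon, polygon]
    congr 1
    ext t
    simp
  rw [h]
  refine MemLp.add (f := fun ω => x (node (2 ^ m) 0) ω • (1 : C(unitInterval, ℝ)))
    (memLp_smul_const (hx _) _) ?_
  refine memLp_finsetSum (f := fun k ω =>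
    (x (node (2 ^ m) (k + 1)) ω - x (node (2 ^ m) k) ω) • ramp (2 ^ m) k) _ fun k _ => ?_
  exact memLp_smul_const (f := fun ω => x (node (2 ^ m) (k + 1)) ω - x (node (2 ^ m) k) ω)
    ((hx _).sub (hx _)) _

theorem eLpNorm_fun_sub_self {E : Type*} [NormedAddCommGroup E] (f : Ω → E) {p : ℝ≥0∞} :
    eLpNorm (fun ω => f ω - f ω) p P = 0 := by
  simp

theorem eLpNorm_two_le_of_lintegral {E : Type*} [NormedAddCommGroup E] {f : Ω → E} {c : ℝ}
    (hc : 0 ≤ c) (h : ∫⁻ ω, ‖f ω‖ₑ ^ 2 ∂P ≤ ENNReal.ofReal (c ^ 2)) :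
    eLpNorm f 2 P ≤ ENNReal.ofReal c := by
  rw [eLpNorm_eq_lintegral_rpow_enorm_toReal two_ne_zero ENNReal.ofNat_ne_top]
  simp only [ENNReal.toReal_ofNat, ENNReal.rpow_ofNat]
  refine (ENNReal.rpow_le_rpow h (by norm_num)).trans ?_
  rw [ENNReal.ofReal_pow hc, ← ENNReal.rpow_ofNat, ← ENNReal.rpow_mul]
  norm_num

/-- The second moments of the increments of `x` are dominated by those of a process that is Hölder
continuous in mean square of some order larger than `1/2`. -/
def IncrementBound (P : Measure Ω) (x : unitInterval → Ω → ℝ) (K γ : ℝ) : Prop :=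
  ∀ s t : unitInterval, ∫⁻ ω, ‖x t ω - x s ω‖ₑ ^ 2 ∂P ≤
    ENNReal.ofReal (K * |(t : ℝ) - s| ^ (1 + γ))

/-- There are `2^(m+1)` increments, each with second moment at most `K 2^(-(m+1)(1+γ))`; the excess
`γ` of the exponent over one leaves geometric decay. -/
theorem lintegral_dyadicPolygon_succ_sub_le {x : unitInterval → Ω → ℝ}
    (hx : ∀ t, AEMeasurable (x t) P) {K γ : ℝ} (hK : 0 ≤ K) (hγ : 0 < γ)
    (h : IncrementBound P x K γ) (m : ℕ) :
    ∫⁻ ω, ‖dyadicPolygon x (m + 1) ω - dyadicPolygon x m ω‖ₑ ^ 2 ∂P ≤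
      ENNReal.ofReal (K * ((2 : ℝ) ^ (-γ)) ^ (m + 1)) := by
  have hpt : ∀ ω, ‖dyadicPolygon x (m + 1) ω - dyadicPolygon x m ω‖ₑ ^ 2 ≤
      ∑ k ∈ Finset.range (2 ^ (m + 1)),
        ‖x (node (2 ^ (m + 1)) (k + 1)) ω - x (node (2 ^ (m + 1)) k) ω‖ₑ ^ 2 := by
    intro ω
    have h1 := norm_polygon_two_mul_sub_sq_le (2 ^ m) (fun k => x (node (2 * 2 ^ m) k) ω)
    simp only [node_two_mul] at h1
    rw [← pow_succ'] at h1
    have h2 := ENNReal.ofReal_le_ofReal h1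
    rw [ENNReal.ofReal_sum_of_nonneg fun _ _ => sq_nonneg _, ENNReal.ofReal_pow (norm_nonneg _),
      ofReal_norm] at h2
    refine h2.trans (le_of_eq (Finset.sum_congr rfl fun k _ => ?_))
    rw [← sq_abs, ENNReal.ofReal_pow (abs_nonneg _), ← Real.norm_eq_abs, ofReal_norm]
  refine (lintegral_mono hpt).trans ?_
  rw [lintegral_finsetSum' (f := fun k ω =>
    ‖x (node (2 ^ (m + 1)) (k + 1)) ω - x (node (2 ^ (m + 1)) k) ω‖ₑ ^ 2) _
    fun k _ => (((hx _).sub (hx _)).enorm.pow_const 2)]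
  have hterm : ∀ k ∈ Finset.range (2 ^ (m + 1)),
      ∫⁻ ω, ‖x (node (2 ^ (m + 1)) (k + 1)) ω - x (node (2 ^ (m + 1)) k) ω‖ₑ ^ 2 ∂P ≤
        ENNReal.ofReal (K * ((1 / 2 : ℝ) ^ (m + 1)) ^ (1 + γ)) := by
    intro k _
    refine (h _ _).trans (ENNReal.ofReal_le_ofReal ?_)
    have := abs_node_succ_sub_le (N := 2 ^ (m + 1)) k
    push_cast at this
    rw [← one_div_pow] at this
    gcongr
  refine (Finset.sum_le_sum hterm).trans (le_of_eq ?_)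
  rw [Finset.sum_const, Finset.card_range, nsmul_eq_mul, ← ENNReal.ofReal_natCast,
    ← ENNReal.ofReal_mul (by positivity)]
  congr 1
  push_cast
  have e : ((1 / 2 : ℝ) ^ (m + 1)) ^ (1 + γ) = (1 / 2 : ℝ) ^ (m + 1) * ((2 : ℝ) ^ (-γ)) ^ (m + 1) := by
    rw [Real.rpow_add (by positivity), Real.rpow_one, Real.rpow_neg (by norm_num),
      ← Real.inv_rpow (by norm_num), ← Real.rpow_natCast (((2 : ℝ)⁻¹) ^ γ), ← Real.rpow_mul
      (by norm_num), mul_comm γ, Real.rpow_mul (by norm_num), Real.rpow_natCast]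
    norm_num
  rw [e, one_div, inv_pow]
  field_simp

/-- The ratio of the geometric series that bounds the dyadic approximations. -/
noncomputable def chainRatio (γ : ℝ) : ℝ := Real.sqrt ((2 : ℝ) ^ (-γ))

theorem chainRatio_pos (γ : ℝ) : 0 < chainRatio γ := Real.sqrt_pos.2 (by positivity)

theorem chainRatio_lt_one {γ : ℝ} (hγ : 0 < γ) : chainRatio γ < 1 := by
  rw [chainRatio, Real.sqrt_lt' one_pos, one_pow]
  exact Real.rpow_lt_one_of_one_lt_of_neg one_lt_two (by linarith)

/-- The bound for the distance in mean square of the dyadic approximation of level `m`. -/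
noncomputable def chainBound (K γ : ℝ) (m : ℕ) : ℝ :=
  Real.sqrt K * chainRatio γ ^ m / (1 - chainRatio γ)

theorem chainBound_nonneg (K : ℝ) {γ : ℝ} (hγ : 0 < γ) (m : ℕ) : 0 ≤ chainBound K γ m :=
  div_nonneg (mul_nonneg (Real.sqrt_nonneg _) (pow_nonneg (chainRatio_pos _).le _))
    (sub_nonneg.2 (chainRatio_lt_one hγ).le)

theorem tendsto_chainBound (K : ℝ) {γ : ℝ} (hγ : 0 < γ) :
    Tendsto (chainBound K γ) atTop (𝓝 0) := by
  have h := ((tendsto_pow_atTop_nhds_zero_of_lt_one (chainRatio_pos γ).le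
    (chainRatio_lt_one hγ)).const_mul (Real.sqrt K)).div_const (1 - chainRatio γ)
  rw [mul_zero, zero_div] at h
  exact h

theorem eLpNorm_dyadicPolygon_succ_sub_le {x : unitInterval → Ω → ℝ}
    (hx : ∀ t, AEMeasurable (x t) P) {K γ : ℝ} (hK : 0 ≤ K) (hγ : 0 < γ)
    (h : IncrementBound P x K γ) (m : ℕ) :
    eLpNorm (fun ω => dyadicPolygon x (m + 1) ω - dyadicPolygon x m ω) 2 P ≤
      ENNReal.ofReal (Real.sqrt K * chainRatio γ ^ m) := by
  have h0 := (chainRatio_pos γ).le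
  refine eLpNorm_two_le_of_lintegral (by positivity) ?_
  refine (lintegral_dyadicPolygon_succ_sub_le hx hK hγ h m).trans (ENNReal.ofReal_le_ofReal ?_)
  have e : (2 : ℝ) ^ (-γ) = chainRatio γ ^ 2 := (Real.sq_sqrt (by positivity)).symm
  rw [e, mul_pow, Real.sq_sqrt hK, ← pow_mul, ← pow_mul]
  refine mul_le_mul_of_nonneg_left ?_ hK
  exact pow_le_pow_of_le_one h0 (chainRatio_lt_one hγ).le (by omega)

theorem eLpNorm_dyadicPolygon_add_sub_le {x : unitInterval → Ω → ℝ}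
    (hx : ∀ t, AEMeasurable (x t) P) {K γ : ℝ} (hK : 0 ≤ K) (hγ : 0 < γ)
    (h : IncrementBound P x K γ) (m p : ℕ) :
    eLpNorm (fun ω => dyadicPolygon x (m + p) ω - dyadicPolygon x m ω) 2 P ≤
      ENNReal.ofReal (chainBound K γ m) := by
  have h0 := (chainRatio_pos γ).le
  have h1 := chainRatio_lt_one hγ
  have hm : ∀ m, AEStronglyMeasurable (dyadicPolygon x m) P := fun m =>
    (aemeasurable_dyadicPolygon hx m).aestronglyMeasurable
  have key : eLpNorm (fun ω => dyadicPolygon x (m + p) ω - dyadicPolygon x m ω) 2 P ≤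
      ENNReal.ofReal (Real.sqrt K * chainRatio γ ^ m * ∑ i ∈ Finset.range p, chainRatio γ ^ i) := by
    induction p with
    | zero => exact (eLpNorm_fun_sub_self _).trans_le zero_le
    | succ p ih =>
      have e : (fun ω => dyadicPolygon x (m + (p + 1)) ω - dyadicPolygon x m ω) =
          (fun ω => dyadicPolygon x (m + p + 1) ω - dyadicPolygon x (m + p) ω) +
          fun ω => dyadicPolygon x (m + p) ω - dyadicPolygon x m ω := by
        funext ω
        simp [add_assoc]
      rw [e]
      refine (eLpNorm_add_le ((hm _).sub (hm _)) ((hm _).sub (hm _)) one_le_two).trans ?_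
      refine (add_le_add (eLpNorm_dyadicPolygon_succ_sub_le hx hK hγ h _) ih).trans ?_
      rw [← ENNReal.ofReal_add (by positivity)
        (mul_nonneg (by positivity) (Finset.sum_nonneg fun _ _ => by positivity)),
        Finset.sum_range_succ]
      refine ENNReal.ofReal_le_ofReal (le_of_eq ?_)
      rw [pow_add]
      ring
  refine key.trans (ENNReal.ofReal_le_ofReal ?_)
  rw [chainBound, div_eq_mul_inv]
  refine mul_le_mul_of_nonneg_left ?_ (by positivity)
  have := summable_geometric_of_lt_one h0 h1
  rw [← tsum_geometric_of_lt_one h0 h1]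
  exact this.sum_le_tsum _ fun _ _ => by positivity

/-- A random continuous path is close in mean square to its dyadic approximations. -/
theorem eLpNorm_sub_dyadicPolygon_le {F : Ω → C(unitInterval, ℝ)} (hF : AEMeasurable F P)
    {K γ : ℝ} (hK : 0 ≤ K) (hγ : 0 < γ) (h : IncrementBound P (fun t ω => F ω t) K γ) (m : ℕ) :
    eLpNorm (fun ω => F ω - dyadicPolygon (fun t ω => F ω t) m ω) 2 P ≤
      ENNReal.ofReal (chainBound K γ m) := by
  have hx : ∀ t : unitInterval, AEMeasurable (fun ω => F ω t) P := fun t =>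
    (continuous_eval_const t).measurable.comp_aemeasurable hF
  have hm : ∀ m, AEStronglyMeasurable (dyadicPolygon (fun t ω => F ω t) m) P := fun m =>
    (aemeasurable_dyadicPolygon hx m).aestronglyMeasurable
  -- Let `p → ∞` in the bound between levels `m` and `m + p`: the polygons converge uniformly to the
  -- continuous path, and the `L²` norm is lower semicontinuous.
  refine Lp.eLpNorm_le_of_ae_tendsto (u := atTop)
    (Eventually.of_forall fun p => eLpNorm_dyadicPolygon_add_sub_le hx hK hγ h m p)
    (fun p => (hm _).sub (hm _)) (ae_of_all _ fun ω => ?_)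
  have := (tendsto_polygon (F ω)).comp (tendsto_add_atTop_nat m)
  refine Tendsto.sub_const ?_ _
  simpa [dyadicPolygon, Function.comp_def, add_comm] using this

/-- A mean square version of the Kolmogorov-Chentsov theorem. -/
theorem exists_continuous_version [IsFiniteMeasure P] {x : unitInterval → Ω → ℝ}
    (hx : ∀ t, MemLp (x t) 2 P) {K γ : ℝ} (hK : 0 ≤ K) (hγ : 0 < γ)
    (h : IncrementBound P x K γ) :
    ∃ ζ : Ω → C(unitInterval, ℝ), AEMeasurable ζ P ∧ ∀ t, (fun ω => ζ ω t) =ᵐ[P] x t := by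
  have hxm : ∀ t, AEMeasurable (x t) P := fun t => (hx t).1.aemeasurable
  have h0 := (chainRatio_pos γ).le
  have h1 := chainRatio_lt_one hγ
  have hD := memLp_dyadicPolygon hx
  -- Two polygons beyond level `N` are each within `chainBound K γ N` of level `N`; the added power
  -- of `chainRatio γ` only makes the inequality strict, also when `K = 0`.
  obtain ⟨ζ, hζ, hlim⟩ := Lp.cauchy_complete_eLpNorm (p := 2) one_le_two hD
    (B := fun m => ENNReal.ofReal (2 * chainBound K γ m + chainRatio γ ^ m)) (by
      have hs : Summable fun m => 2 * chainBound K γ m + chainRatio γ ^ m := by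
        refine Summable.add (Summable.mul_left _ ?_) (summable_geometric_of_lt_one h0 h1)
        exact ((summable_geometric_of_lt_one h0 h1).mul_left _).div_const _
      rw [← ENNReal.ofReal_tsum_of_nonneg (fun m => by
        have := chainBound_nonneg K hγ m; positivity) hs]
      exact ENNReal.ofReal_ne_top) (by
      intro N n m hn hm
      obtain ⟨p, rfl⟩ := Nat.exists_eq_add_of_le hn
      obtain ⟨q, rfl⟩ := Nat.exists_eq_add_of_le hm
      have e : dyadicPolygon x (N + p) - dyadicPolygon x (N + q) =
          (fun ω => dyadicPolygon x (N + p) ω - dyadicPolygon x N ω) -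
          fun ω => dyadicPolygon x (N + q) ω - dyadicPolygon x N ω := by
        funext ω; simp
      rw [e]
      refine lt_of_le_of_lt (eLpNorm_sub_le ((hD _).1.sub (hD _).1) ((hD _).1.sub (hD _).1)
        one_le_two) ?_
      refine lt_of_le_of_lt (add_le_add (eLpNorm_dyadicPolygon_add_sub_le hxm hK hγ h N p)
        (eLpNorm_dyadicPolygon_add_sub_le hxm hK hγ h N q)) ?_
      have hb := chainBound_nonneg K hγ N
      have hr : 0 < chainRatio γ ^ N := pow_pos (chainRatio_pos γ) N
      rw [← ENNReal.ofReal_add hb hb, ENNReal.ofReal_lt_ofReal_iff (by positivity)]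
      linarith)
  refine ⟨ζ, hζ.1.aemeasurable, fun t => ?_⟩
  have hζt : AEStronglyMeasurable (fun ω => ζ ω t) P :=
    (continuous_eval_const t).comp_aestronglyMeasurable hζ.1
  have hDt : ∀ m, AEStronglyMeasurable (fun ω => dyadicPolygon x m ω t) P := fun m =>
    (continuous_eval_const t).comp_aestronglyMeasurable (hD m).1
  -- At a fixed `t` the polygon lies between the values of `x` at two nodes within `2^(-m)` of `t`,
  -- so mean square continuity gives convergence to `x t`. Comparison with the limit `ζ` identifies
  -- `ζ t` with `x t` almost surely.
  have hsub : Tendsto (fun m : ℕ => eLpNorm (fun ω => dyadicPolygon x m ω t - x t ω) 2 P) atTop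
      (𝓝 0) := by
    have hr : ∀ s : unitInterval, ∀ m : ℕ, |(t : ℝ) - s| ≤ 1 / ((2 ^ m : ℕ) : ℝ) →
        eLpNorm (fun ω => x s ω - x t ω) 2 P ≤ ENNReal.ofReal (Real.sqrt K * chainRatio γ ^ m) := by
      intro s m hs
      rw [show (fun ω => x s ω - x t ω) = x s - x t from rfl, eLpNorm_sub_comm]
      refine eLpNorm_two_le_of_lintegral (by positivity) ((h s t).trans
        (ENNReal.ofReal_le_ofReal ?_))
      rw [mul_pow, Real.sq_sqrt hK, ← pow_mul, mul_comm m, pow_mul, chainRatio,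
        Real.sq_sqrt (by positivity)]
      refine mul_le_mul_of_nonneg_left ?_ hK
      have hle : |(t : ℝ) - s| ≤ 1 := by
        have a := t.2; have b := s.2
        rw [abs_le]; constructor <;> linarith [a.1, a.2, b.1, b.2]
      calc |(t : ℝ) - s| ^ (1 + γ) ≤ |(t : ℝ) - s| ^ γ :=
            Real.rpow_le_rpow_of_exponent_ge_of_imp (abs_nonneg _) hle (by linarith)
              (fun _ _ => by linarith)
        _ ≤ (1 / ((2 ^ m : ℕ) : ℝ)) ^ γ := by gcongr
        _ = ((2 : ℝ) ^ (-γ)) ^ m := by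
            rw [Real.rpow_neg (by norm_num), inv_pow, ← Real.rpow_natCast, ← Real.rpow_mul
              (by norm_num), mul_comm γ, Real.rpow_mul (by norm_num), Real.rpow_natCast,
              one_div, Real.inv_rpow (by positivity)]
            push_cast; rfl
    have hlim0 : Tendsto (fun m : ℕ => ENNReal.ofReal (Real.sqrt K * chainRatio γ ^ m) +
        ENNReal.ofReal (Real.sqrt K * chainRatio γ ^ m)) atTop (𝓝 0) := by
      have a := ENNReal.tendsto_ofReal
        ((tendsto_pow_atTop_nhds_zero_of_lt_one h0 h1).const_mul (Real.sqrt K))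
      simpa using a.add a
    refine tendsto_of_tendsto_of_tendsto_of_le_of_le tendsto_const_nhds hlim0
      (fun _ => zero_le) fun m => ?_
    obtain ⟨n1, n2⟩ := abs_node_floor_sub_le (N := 2 ^ m) (by positivity) t
    rw [abs_sub_comm] at n1 n2
    refine le_trans ?_ (add_le_add (hr _ m n1) (hr _ m n2))
    have hmono := eLpNorm_mono_real (p := 2) (μ := P)
      (f := fun ω => dyadicPolygon x m ω t - x t ω)
      (g := (fun ω => |x (node (2 ^ m) ⌊((2 ^ m : ℕ) : ℝ) * t⌋₊) ω - x t ω|) +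
        fun ω => |x (node (2 ^ m) (⌊((2 ^ m : ℕ) : ℝ) * t⌋₊ + 1)) ω - x t ω|)
      (fun ω => abs_polygon_sub_le (2 ^ m) (fun k => x (node (2 ^ m) k) ω) t (x t ω))
    refine hmono.trans ((eLpNorm_add_le (((hx _).1.sub (hx _).1).norm)
      (((hx _).1.sub (hx _).1).norm) one_le_two).trans (le_of_eq ?_))
    congr 1
    · exact eLpNorm_norm (fun ω => x (node (2 ^ m) ⌊((2 ^ m : ℕ) : ℝ) * t⌋₊) ω - x t ω)
    · exact eLpNorm_norm (fun ω => x (node (2 ^ m) (⌊((2 ^ m : ℕ) : ℝ) * t⌋₊ + 1)) ω - x t ω)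
  have hsub' : Tendsto (fun m : ℕ => eLpNorm (fun ω => dyadicPolygon x m ω t - ζ ω t) 2 P) atTop
      (𝓝 0) := by
    refine tendsto_of_tendsto_of_tendsto_of_le_of_le tendsto_const_nhds hlim
      (fun _ => zero_le) fun m => ?_
    exact eLpNorm_mono fun ω => ContinuousMap.norm_coe_le_norm (dyadicPolygon x m ω - ζ ω) t
  have hzero : eLpNorm (fun ω => ζ ω t - x t ω) 2 P = 0 := by
    refine le_antisymm (ge_of_tendsto' (f := fun m : ℕ =>
      eLpNorm (fun ω => dyadicPolygon x m ω t - x t ω) 2 P +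
        eLpNorm (fun ω => dyadicPolygon x m ω t - ζ ω t) 2 P) (by simpa using hsub.add hsub')
      fun m => ?_) zero_le
    have e : (fun ω => ζ ω t - x t ω) = (fun ω => dyadicPolygon x m ω t - x t ω) -
        fun ω => dyadicPolygon x m ω t - ζ ω t := by
      funext ω; simp
    rw [e]
    exact eLpNorm_sub_le ((hDt m).sub (hx t).1) ((hDt m).sub hζt) one_le_two
  filter_upwards [(eLpNorm_eq_zero_iff (hζt.sub (hx t).1) two_ne_zero).1 hzero] with ω hω
  exact sub_eq_zero.1 hω

end Chaining

/-! ### Criteria for convergence in distribution -/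

section Weak

variable {Ω Ω' : Type*} [MeasurableSpace Ω] [MeasurableSpace Ω']
  {P : Measure Ω} [IsProbabilityMeasure P] {P' : Measure Ω'} [IsProbabilityMeasure P']

/-- Bounded Lipschitz functions determine weak convergence and see only the `L¹` distance, which the
`L²` distance dominates on a probability space. -/
theorem abs_integral_lipschitz_sub_le {E : Type*} [NormedAddCommGroup E] [MeasurableSpace E]
    [BorelSpace E] [SecondCountableTopology E] {X Y : Ω → E} (hX : AEMeasurable X P)
    (hY : AEMeasurable Y P) {f : E → ℝ} {C : ℝ} (hf : ∀ x y, dist (f x) (f y) ≤ C) {L : ℝ≥0}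
    (hL : LipschitzWith L f) {b : ℝ} (hb : 0 ≤ b)
    (h : eLpNorm (fun ω => X ω - Y ω) 2 P ≤ ENNReal.ofReal b) :
    |∫ ω, f (X ω) ∂P - ∫ ω, f (Y ω) ∂P| ≤ L * b := by
  have hint : ∀ {W : Ω → E}, AEMeasurable W P → Integrable (fun ω => f (W ω)) P := by
    intro W hW
    refine Integrable.of_bound (C := |f 0| + C)
      (hL.continuous.measurable.comp_aemeasurable hW).aestronglyMeasurable
      (ae_of_all _ fun ω => ?_)
    have := hf (W ω) 0
    rw [Real.dist_eq] at this
    rw [Real.norm_eq_abs]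
    linarith [abs_sub_abs_le_abs_sub (f (W ω)) (f 0)]
  have hmeas : AEStronglyMeasurable (fun ω => X ω - Y ω) P :=
    hX.aestronglyMeasurable.sub hY.aestronglyMeasurable
  have h1 : eLpNorm (fun ω => X ω - Y ω) 1 P ≤ ENNReal.ofReal b :=
    (eLpNorm_le_eLpNorm_of_exponent_le one_le_two hmeas).trans h
  have hXY : Integrable (fun ω => X ω - Y ω) P :=
    memLp_one_iff_integrable.1 ⟨hmeas, h1.trans_lt ENNReal.ofReal_lt_top⟩
  rw [← integral_sub (hint hX) (hint hY)]
  calc |∫ ω, (f (X ω) - f (Y ω)) ∂P| ≤ ∫ ω, |f (X ω) - f (Y ω)| ∂P := abs_integral_le_integral_abs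
    _ ≤ ∫ ω, L * ‖X ω - Y ω‖ ∂P := by
        refine integral_mono ((hint hX).sub (hint hY)).abs (hXY.norm.const_mul _) fun ω => ?_
        have := hL.dist_le_mul (X ω) (Y ω)
        rwa [Real.dist_eq, dist_eq_norm] at this
    _ = L * ∫ ω, ‖X ω - Y ω‖ ∂P := integral_const_mul _ _
    _ ≤ L * b := by
        refine mul_le_mul_of_nonneg_left ?_ L.2
        rw [integral_norm_eq_lintegral_enorm hmeas, ← eLpNorm_one_eq_lintegral_enorm]
        exact ENNReal.toReal_le_of_le_ofReal hb h1

/-- Convergence in distribution of uniformly good mean square approximations implies convergence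
in distribution. -/
theorem tendstoInDistribution_of_approx {E : Type*} [NormedAddCommGroup E] [MeasurableSpace E]
    [BorelSpace E] [SecondCountableTopology E] {F : ℕ → Ω → E} {G : Ω' → E}
    {FA : ℕ → ℕ → Ω → E} {GA : ℕ → Ω' → E} (hF : ∀ n, AEMeasurable (F n) P)
    (hG : AEMeasurable G P') {b : ℕ → ℝ} (hb0 : ∀ m, 0 ≤ b m) (hb : Tendsto b atTop (𝓝 0))
    (hFA : ∀ m, ∀ᶠ n in atTop, eLpNorm (fun ω => F n ω - FA m n ω) 2 P ≤ ENNReal.ofReal (b m))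
    (hGA : ∀ m, eLpNorm (fun ω => G ω - GA m ω) 2 P' ≤ ENNReal.ofReal (b m))
    (h : ∀ m, TendstoInDistribution (FA m) atTop (GA m) (fun _ => P) P') :
    TendstoInDistribution F atTop G (fun _ => P) P' := by
  refine ⟨hF, hG, ?_⟩
  refine tendsto_iff_forall_lipschitz_integral_tendsto.2 ?_
  rintro f ⟨C, hC⟩ ⟨L, hL⟩
  have key : ∀ m, Tendsto (fun n => ∫ ω, f (FA m n ω) ∂P) atTop (𝓝 (∫ ω, f (GA m ω) ∂P')) := by
    intro m
    have h1 := tendsto_iff_forall_lipschitz_integral_tendsto.1 (h m).tendsto f ⟨C, hC⟩ ⟨L, hL⟩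
    simp only [ProbabilityMeasure.coe_mk] at h1
    rw [integral_map (h m).aemeasurable_limit hL.continuous.aestronglyMeasurable] at h1
    refine h1.congr fun n => ?_
    rw [integral_map ((h m).forall_aemeasurable n) hL.continuous.aestronglyMeasurable]
  simp only [ProbabilityMeasure.coe_mk]
  rw [integral_map hG hL.continuous.aestronglyMeasurable]
  have e : ∀ n, ∫ x, f x ∂(P.map (F n)) = ∫ ω, f (F n ω) ∂P := fun n =>
    integral_map (hF n) hL.continuous.aestronglyMeasurable
  simp only [e]
  rw [Metric.tendsto_nhds]
  intro ε hε
  -- Passing to the approximations costs `L * b m` on each side; `m` is fixed so that both costs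
  -- together stay below `ε / 2`, and only then is `n` taken large.
  have hsmall : Tendsto (fun m => (L : ℝ) * b m + L * b m) atTop (𝓝 0) := by
    simpa using (hb.const_mul (L : ℝ)).add (hb.const_mul (L : ℝ))
  obtain ⟨m, hm⟩ := (hsmall.eventually_lt_const (show 0 < ε / 2 by positivity)).exists
  filter_upwards [hFA m, Metric.tendsto_nhds.1 (key m) (ε / 2) (by positivity)] with n h1 h2
  have a1 := abs_integral_lipschitz_sub_le (hF n) ((h m).forall_aemeasurable n) hC hL (hb0 m) h1
  have a2 := abs_integral_lipschitz_sub_le hG (h m).aemeasurable_limit hC hL (hb0 m) (hGA m)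
  rw [Real.dist_eq] at h2 ⊢
  rw [abs_lt] at h2 ⊢
  rw [abs_le] at a1 a2
  constructor <;> linarith [a1.1, a1.2, a2.1, a2.2, h2.1, h2.2]

theorem polygon_congr {N : ℕ} {x y : ℕ → ℝ} (h : ∀ k ≤ N, x k = y k) :
    polygon N x = polygon N y := by
  unfold polygon
  rw [h 0 (Nat.zero_le _)]
  congr 1
  refine Finset.sum_congr rfl fun k hk => ?_
  have := Finset.mem_range.1 hk
  rw [h k (by omega), h (k + 1) (by omega)]

/-- Weak convergence in `C[0,1]` follows from the convergence of the finite-dimensional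
characteristic functions and a uniform bound on the second moments of the increments. -/
theorem tendstoInDistribution_of_charFun {F : ℕ → Ω → C(unitInterval, ℝ)}
    {G : Ω' → C(unitInterval, ℝ)} (hF : ∀ n, AEMeasurable (F n) P) (hG : AEMeasurable G P')
    {K γ : ℝ} (hK : 0 ≤ K) (hγ : 0 < γ)
    (hFb : ∀ᶠ n in atTop, IncrementBound P (fun t ω => F n ω t) K γ)
    (hGb : IncrementBound P' (fun t ω => G ω t) K γ)
    (hchar : ∀ (N : ℕ) (a : Fin N → ℝ) (t : Fin N → unitInterval),
      Tendsto (fun n => ∫ ω, Complex.exp (((∑ k, a k * F n ω (t k) : ℝ) : ℂ) * Complex.I) ∂P) atTop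
        (𝓝 (∫ ω, Complex.exp (((∑ k, a k * G ω (t k) : ℝ) : ℂ) * Complex.I) ∂P'))) :
    TendstoInDistribution F atTop G (fun _ => P) P' := by
  refine tendstoInDistribution_of_approx
    (FA := fun m n => dyadicPolygon (fun t ω => F n ω t) m)
    (GA := fun m => dyadicPolygon (fun t ω => G ω t) m) hF hG (chainBound_nonneg K hγ)
    (tendsto_chainBound K hγ)
    (fun m => hFb.mono fun n hn => eLpNorm_sub_dyadicPolygon_le (hF n) hK hγ hn m)
    (fun m => eLpNorm_sub_dyadicPolygon_le hG hK hγ hGb m) fun m => ?_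
  -- The dyadic polygon factors as `g ∘ V`: sampling at the nodes, then interpolation. Lévy's
  -- continuity theorem applies to the samples, and the continuous `g` carries the convergence back
  -- to paths.
  let V : C(unitInterval, ℝ) → EuclideanSpace ℝ (Fin (2 ^ m + 1)) := fun f =>
    WithLp.toLp 2 fun k => f (node (2 ^ m) k)
  have hV : Continuous V := by
    refine (PiLp.continuous_toLp 2 _).comp (continuous_pi fun k => continuous_eval_const _)
  -- `Fin.ofNat` reduces indices modulo `2 ^ m + 1`; the polygon reads only indices up to `2 ^ m`,
  -- where this changes nothing.
  let g : EuclideanSpace ℝ (Fin (2 ^ m + 1)) → C(unitInterval, ℝ) := fun v =>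
    polygon (2 ^ m) fun k => v (Fin.ofNat (2 ^ m + 1) k)
  have hg : Continuous g := (continuous_polygon _).comp (continuous_pi fun k => by fun_prop)
  have hgV : ∀ f, g (V f) = polygon (2 ^ m) fun k => f (node (2 ^ m) k) := by
    intro f
    refine polygon_congr fun k hk => ?_
    simp only [V]
    congr 2
    simp [Fin.ofNat, Nat.mod_eq_of_lt (Nat.lt_succ_of_le hk)]
  have hVF : TendstoInDistribution (fun n ω => V (F n ω)) atTop (fun ω => V (G ω))
      (fun _ => P) P' := by
    refine ⟨fun n => hV.measurable.comp_aemeasurable (hF n), hV.measurable.comp_aemeasurable hG, ?_⟩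
    refine ProbabilityMeasure.tendsto_of_tendsto_charFun fun a => ?_
    simp only [ProbabilityMeasure.coe_mk]
    have hin : ∀ f : C(unitInterval, ℝ), inner ℝ (V f) a =
        ∑ k : Fin (2 ^ m + 1), a k * f (node (2 ^ m) k) := by
      intro f
      simp [V, PiLp.inner_apply]
    have hexp : Continuous fun v : EuclideanSpace ℝ (Fin (2 ^ m + 1)) =>
        Complex.exp ((inner ℝ v a : ℝ) * Complex.I) := by fun_prop
    have hG' := hchar (2 ^ m + 1) a fun k => node (2 ^ m) k
    rw [charFun_apply, integral_map (φ := fun ω => V (G ω))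
      (hV.measurable.comp_aemeasurable hG) hexp.aestronglyMeasurable]
    simp only [hin]
    refine hG'.congr fun n => ?_
    rw [charFun_apply, integral_map (φ := fun ω => V (F n ω))
      (hV.measurable.comp_aemeasurable (hF n)) hexp.aestronglyMeasurable]
    simp only [hin]
  have hlim := hVF.continuous_comp hg
  have e1 : (fun n => g ∘ fun ω => V (F n ω)) = fun n => dyadicPolygon (fun t ω => F n ω t) m := by
    funext n ω
    exact hgV (F n ω)
  have e2 : (g ∘ fun ω => V (G ω)) = dyadicPolygon (fun t ω => G ω t) m := by
    funext ω
    exact hgV (G ω)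
  rw [← e1, ← e2]
  exact hlim

end Weak

/-! ### Weighted sums of independent identically distributed random variables -/

section WeightedSum

variable {Ω : Type*} [MeasurableSpace Ω] {P : Measure Ω}

theorem summable_sq_of_summable_abs {ι : Type*} {d : ι → ℝ} (hd : Summable fun j => |d j|) :
    Summable fun j => d j ^ 2 := by
  have h : ∀ᶠ j in cofinite, |d j| ≤ 1 := by
    filter_upwards [hd.tendsto_cofinite_zero.eventually_lt_const zero_lt_one] with j hj using hj.le
  refine summable_of_isBigO hd (Asymptotics.IsBigO.of_bound 1 ?_)
  filter_upwards [h] with j hj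
  rw [Real.norm_eq_abs, Real.norm_eq_abs, abs_abs, one_mul, abs_pow, pow_two]
  exact mul_le_of_le_one_left (abs_nonneg _) hj

/-- By Tonelli the expected sum of absolute values is `E|Z 0|` times `∑ |d j|`, hence finite.
Independence plays no role here. -/
theorem ae_summable_mul {Z : ℤ → Ω → ℝ} (hident : ∀ j, IdentDistrib (Z j) (Z 0) P P)
    (hint : Integrable (Z 0) P) {d : ℤ → ℝ} (hd : Summable fun j => |d j|) :
    ∀ᵐ ω ∂P, Summable fun j => d j * Z j ω := by
  have hm : ∀ j, AEMeasurable (Z j) P := fun j => (hident j).aemeasurable_fst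
  have h1 : ∫⁻ ω, ∑' j, ‖d j * Z j ω‖ₑ ∂P ≠ ∞ := by
    rw [lintegral_tsum fun j => ((hm j).const_mul (d j)).enorm]
    have e : ∀ j, ∫⁻ ω, ‖d j * Z j ω‖ₑ ∂P = ENNReal.ofReal |d j| * ∫⁻ ω, ‖Z 0 ω‖ₑ ∂P := by
      intro j
      simp only [enorm_mul]
      rw [lintegral_const_mul'' _ (hm j).enorm, Real.enorm_eq_ofReal_abs]
      congr 1
      exact ((hident j).comp measurable_enorm).lintegral_eq
    simp only [e]
    rw [ENNReal.tsum_mul_right, ← ENNReal.ofReal_tsum_of_nonneg (fun _ => abs_nonneg _) hd]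
    exact ENNReal.mul_ne_top ENNReal.ofReal_ne_top hint.2.ne
  have h2 := ae_lt_top' (AEMeasurable.tsum fun j => ((hm j).const_mul (d j)).enorm) h1
  filter_upwards [h2] with ω hω
  refine Summable.of_norm ?_
  have h3 := ENNReal.summable_toReal hω.ne
  simpa using h3

theorem lintegral_enorm_sq_eq {E : Type*} [NormedAddCommGroup E] (f : Ω → E) :
    ∫⁻ ω, ‖f ω‖ₑ ^ 2 ∂P = eLpNorm f 2 P ^ 2 := by
  rw [eLpNorm_eq_lintegral_rpow_enorm_toReal two_ne_zero ENNReal.ofNat_ne_top,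
    ← ENNReal.rpow_ofNat, ← ENNReal.rpow_mul]
  norm_num

theorem integral_exp_finsetSum_mul {Z : ℤ → Ω → ℝ} (hindep : iIndepFun Z P)
    (hident : ∀ j, IdentDistrib (Z j) (Z 0) P P) (d : ℤ → ℝ) (s : Finset ℤ) :
    ∫ ω, Complex.exp (((∑ j ∈ s, d j * Z j ω : ℝ) : ℂ) * Complex.I) ∂P =
      ∏ j ∈ s, charFun (P.map (Z 0)) (d j) := by
  have hm : ∀ j, AEMeasurable (Z j) P := fun j => (hident j).aemeasurable_fst
  have hdm : ∀ j, AEMeasurable (fun ω => d j * Z j ω) P := fun j => (hm j).const_mul _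
  have hi : iIndepFun (fun j ω => d j * Z j ω) P :=
    hindep.comp (fun j x => d j * x) fun j => measurable_const_mul (d j)
  have h := (hi.restrict s).charFun_map_fun_finsetSum_eq_prod (s := s) fun j _ => hdm j
  have h1 := congrFun h 1
  rw [charFun_apply_real, integral_map (Finset.aemeasurable_fun_sum _ fun j _ => hdm j)
    (by fun_prop), Finset.prod_apply] at h1
  simp only [Complex.ofReal_one, one_mul] at h1
  rw [h1]
  refine Finset.prod_congr rfl fun j _ => ?_
  rw [charFun_map_mul_comp (hm j), (hident j).map_eq, mul_one]

variable [IsProbabilityMeasure P]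

theorem variance_finsetSum_mul {Z : ℤ → Ω → ℝ} (hindep : iIndepFun Z P)
    (hident : ∀ j, IdentDistrib (Z j) (Z 0) P P) (hL2 : MemLp (Z 0) 2 P)
    (hmean : ∫ ω, Z 0 ω ∂P = 0) {v : ℝ≥0} (hv : ∫ ω, Z 0 ω ^ 2 ∂P = v) (d : ℤ → ℝ)
    (s : Finset ℤ) :
    ∫⁻ ω, ‖∑ j ∈ s, d j * Z j ω‖ₑ ^ 2 ∂P = ENNReal.ofReal (v * ∑ j ∈ s, d j ^ 2) := by
  have hZ : ∀ j, MemLp (Z j) 2 P := fun j => (hident j).symm.memLp_snd hL2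
  have hdZ : ∀ j, MemLp (fun ω => d j * Z j ω) 2 P := fun j => (hZ j).const_mul _
  have hvar : ∀ j, variance (Z j) P = v := fun j => by
    rw [(hident j).variance_eq, variance_of_integral_eq_zero hL2.1.aemeasurable hmean, hv]
  have hsum : MemLp (∑ j ∈ s, fun ω => d j * Z j ω) 2 P := memLp_finsetSum' _ fun j _ => hdZ j
  have hzero : ∫ ω, (∑ j ∈ s, fun ω => d j * Z j ω) ω ∂P = 0 := by
    simp only [Finset.sum_apply]
    rw [integral_finsetSum _ fun j _ => (hdZ j).integrable one_le_two]
    refine Finset.sum_eq_zero fun j _ => ?_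
    rw [integral_const_mul, (hident j).integral_eq, hmean, mul_zero]
  have h1 := IndepFun.variance_sum (μ := P) (s := s) (X := fun j ω => d j * Z j ω)
    (fun j _ => hdZ j) fun i _ j _ hij =>
      (hindep.indepFun hij).comp (measurable_const_mul (d i)) (measurable_const_mul (d j))
  rw [variance_of_integral_eq_zero hsum.1.aemeasurable hzero] at h1
  simp only [variance_const_mul, hvar, Finset.sum_apply] at h1
  rw [Finset.mul_sum, Finset.sum_congr rfl fun j _ => mul_comm (v : ℝ) (d j ^ 2), ← h1,
    ofReal_integral_eq_lintegral_ofReal]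
  · refine lintegral_congr fun ω => ?_
    rw [← sq_abs, ENNReal.ofReal_pow (abs_nonneg _), ← Real.enorm_eq_ofReal_abs]
  · have := hsum.integrable_sq
    simpa only [Finset.sum_apply] using this
  · exact ae_of_all _ fun ω => sq_nonneg _

/-- Finite sums have variance `v ∑ d j ^ 2` by independence; Fatou along finite index sets gives the
inequality for the series, which is all that is needed. -/
theorem lintegral_tsum_mul_sq_le {Z : ℤ → Ω → ℝ} (hindep : iIndepFun Z P)
    (hident : ∀ j, IdentDistrib (Z j) (Z 0) P P) (hL2 : MemLp (Z 0) 2 P)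
    (hmean : ∫ ω, Z 0 ω ∂P = 0) {v : ℝ≥0} (hv : ∫ ω, Z 0 ω ^ 2 ∂P = v) {d : ℤ → ℝ}
    (hd : Summable fun j => |d j|) :
    ∫⁻ ω, ‖∑' j, d j * Z j ω‖ₑ ^ 2 ∂P ≤ ENNReal.ofReal (v * ∑' j, d j ^ 2) := by
  have hm : ∀ j, AEMeasurable (Z j) P := fun j => (hident j).aemeasurable_fst
  have hnn : 0 ≤ (v : ℝ) * ∑' j, d j ^ 2 := mul_nonneg v.2 (tsum_nonneg fun _ => sq_nonneg _)
  have h : eLpNorm (fun ω => ∑' j, d j * Z j ω) 2 P ≤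
      ENNReal.ofReal (Real.sqrt (v * ∑' j, d j ^ 2)) := by
    refine Lp.eLpNorm_le_of_ae_tendsto (u := (atTop : Filter (Finset ℤ)))
      (f := fun s ω => ∑ j ∈ s, d j * Z j ω) (Eventually.of_forall fun s => ?_)
      (fun s => (Finset.aemeasurable_fun_sum _ fun j _ =>
        (hm j).const_mul (d j)).aestronglyMeasurable) ?_
    · refine eLpNorm_two_le_of_lintegral (Real.sqrt_nonneg _) ?_
      rw [variance_finsetSum_mul hindep hident hL2 hmean hv, Real.sq_sqrt hnn]
      refine ENNReal.ofReal_le_ofReal (mul_le_mul_of_nonneg_left ?_ v.2)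
      exact (summable_sq_of_summable_abs hd).sum_le_tsum _ fun _ _ => sq_nonneg _
    · filter_upwards [ae_summable_mul hident (hL2.integrable one_le_two) hd] with ω hω
      exact hω.hasSum
  rw [lintegral_enorm_sq_eq]
  refine (pow_le_pow_left' h 2).trans (le_of_eq ?_)
  rw [← ENNReal.ofReal_pow (Real.sqrt_nonneg _), Real.sq_sqrt hnn]

/-- Factors are exchanged one at a time, and the remaining factors have norm at most one. -/
theorem norm_prod_sub_prod_le {ι : Type*} (s : Finset ι) (a b : ι → ℂ) (ha : ∀ i, ‖a i‖ ≤ 1)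
    (hb : ∀ i, ‖b i‖ ≤ 1) : ‖∏ i ∈ s, a i - ∏ i ∈ s, b i‖ ≤ ∑ i ∈ s, ‖a i - b i‖ := by
  classical
  induction s using Finset.induction_on with
  | empty => simp
  | insert i s hi ih =>
    rw [Finset.prod_insert hi, Finset.prod_insert hi, Finset.sum_insert hi]
    have e : a i * ∏ j ∈ s, a j - b i * ∏ j ∈ s, b j =
        (a i - b i) * ∏ j ∈ s, a j + b i * (∏ j ∈ s, a j - ∏ j ∈ s, b j) := by ring
    rw [e]
    refine (norm_add_le _ _).trans ?_
    rw [norm_mul, norm_mul, norm_prod]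
    refine add_le_add (mul_le_of_le_one_right (norm_nonneg _) ?_)
      ((mul_le_of_le_one_left (norm_nonneg _) (hb i)).trans ih)
    exact Finset.prod_le_one (fun _ _ => norm_nonneg _) fun j _ => ha j

/-- Both functions have the second order expansion `1 - v t² / 2` at zero: the first by finiteness
of the second moment, the second with an error of order `t⁴`. -/
theorem charFun_sub_gaussian_isLittleO {X : Ω → ℝ} (hL2 : MemLp X 2 P)
    (hmean : ∫ ω, X ω ∂P = 0) {v : ℝ≥0} (hv : ∫ ω, X ω ^ 2 ∂P = v) :
    (fun t : ℝ => charFun (P.map X) t - Complex.exp ((-(v * t ^ 2 / 2) : ℝ) : ℂ)) =o[𝓝 0]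
      fun t : ℝ => t ^ 2 := by
  have hX := hL2.1.aemeasurable
  have : IsProbabilityMeasure (P.map X) := Measure.isProbabilityMeasure_map hX
  have hid : MemLp id 2 (P.map X) := (memLp_map_measure_iff (by fun_prop) hX).2 hL2
  have h1 : (fun t : ℝ => charFun (P.map X) t - (1 - v * t ^ 2 / 2)) =o[𝓝 0]
      fun t : ℝ => t ^ 2 := by
    have e : ∀ t : ℝ, taylorWithinEval (charFun (P.map X)) 2 Set.univ 0 t =
        1 - v * t ^ 2 / 2 := by
      intro t
      rw [taylorWithinEval_charFun_two_zero hX hid, hmean]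
      have : P[X ^ 2] = (v : ℝ) := hv
      rw [this]
      simp
    have h := taylor_isLittleO_univ (n := 2) (x₀ := 0) (contDiff_charFun hid)
    simpa only [e, sub_zero] using h
  have h2 : (fun t : ℝ => (1 - v * t ^ 2 / 2 : ℂ) - Complex.exp ((-(v * t ^ 2 / 2) : ℝ) : ℂ))
      =o[𝓝 0] fun t : ℝ => t ^ 2 := by
    have hO : (fun t : ℝ => (1 - v * t ^ 2 / 2 : ℂ) - Complex.exp ((-(v * t ^ 2 / 2) : ℝ) : ℂ))
        =O[𝓝 0] fun t : ℝ => t ^ 4 := by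
      refine Asymptotics.IsBigO.of_bound ((v : ℝ) ^ 2 / 4) ?_
      have hs : Tendsto (fun t : ℝ => (v : ℝ) * t ^ 2 / 2) (𝓝 0) (𝓝 0) := by
        have : Continuous fun t : ℝ => (v : ℝ) * t ^ 2 / 2 := by fun_prop
        simpa using this.tendsto 0
      filter_upwards [hs.eventually_lt_const zero_lt_one] with t ht
      have hnn : 0 ≤ (v : ℝ) * t ^ 2 / 2 := by positivity
      have := Real.abs_exp_sub_one_sub_id_le (x := -((v : ℝ) * t ^ 2 / 2))
        (by rw [abs_neg, abs_of_nonneg hnn]; exact ht.le)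
      rw [← Complex.ofReal_exp]
      have e : (1 - v * t ^ 2 / 2 : ℂ) - (Real.exp (-(v * t ^ 2 / 2)) : ℂ) =
          ((-(Real.exp (-(v * t ^ 2 / 2)) - 1 - -(v * t ^ 2 / 2)) : ℝ) : ℂ) := by
        push_cast; ring
      rw [e, Complex.norm_real, norm_neg, Real.norm_eq_abs]
      refine this.trans (le_of_eq ?_)
      rw [Real.norm_eq_abs, abs_of_nonneg (by positivity)]
      ring
    refine hO.trans_isLittleO (Asymptotics.isLittleO_pow_pow (by norm_num))
  refine (h1.add h2).congr_left fun t => by ring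

/-- The characteristic function of a weighted sum with uniformly small weights is close to that
of a Gaussian random variable. -/
theorem norm_integral_exp_tsum_sub_le {Z : ℤ → Ω → ℝ} (hindep : iIndepFun Z P)
    (hident : ∀ j, IdentDistrib (Z j) (Z 0) P P) (hL2 : MemLp (Z 0) 2 P)
    (hmean : ∫ ω, Z 0 ω ∂P = 0) {v : ℝ≥0} (hv : ∫ ω, Z 0 ω ^ 2 ∂P = v) {ε : ℝ} (hε : 0 < ε) :
    ∃ δ > 0, ∀ d : ℤ → ℝ, (Summable fun j => |d j|) → (∀ j, |d j| < δ) →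
      ‖∫ ω, Complex.exp (((∑' j, d j * Z j ω : ℝ) : ℂ) * Complex.I) ∂P -
        Complex.exp ((-(v * (∑' j, d j ^ 2) / 2) : ℝ) : ℂ)‖ ≤ ε * ∑' j, d j ^ 2 := by
  have hm : ∀ j, AEMeasurable (Z j) P := fun j => (hident j).aemeasurable_fst
  have : IsProbabilityMeasure (P.map (Z 0)) := Measure.isProbabilityMeasure_map (hm 0)
  -- For `|d j| < δ` the error in the factor `j` is at most `ε * d j ^ 2`, so the errors sum to the
  -- claimed bound. It holds uniformly over finite sets of indices and passes to the series.
  obtain ⟨δ, hδ, hball⟩ := Metric.eventually_nhds_iff.1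
    ((charFun_sub_gaussian_isLittleO hL2 hmean hv).def hε)
  refine ⟨δ, hδ, fun d hd hsmall => ?_⟩
  have hsq := summable_sq_of_summable_abs hd
  have hfin : ∀ s : Finset ℤ,
      ‖∫ ω, Complex.exp (((∑ j ∈ s, d j * Z j ω : ℝ) : ℂ) * Complex.I) ∂P -
        Complex.exp ((-(v * (∑ j ∈ s, d j ^ 2) / 2) : ℝ) : ℂ)‖ ≤ ε * ∑' j, d j ^ 2 := by
    intro s
    rw [integral_exp_finsetSum_mul hindep hident]
    have e : Complex.exp ((-(v * (∑ j ∈ s, d j ^ 2) / 2) : ℝ) : ℂ) =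
        ∏ j ∈ s, Complex.exp ((-(v * d j ^ 2 / 2) : ℝ) : ℂ) := by
      rw [← Complex.exp_sum, ← Complex.ofReal_sum, Finset.sum_neg_distrib, ← Finset.sum_div,
        ← Finset.mul_sum]
    rw [e]
    refine (norm_prod_sub_prod_le s _ _ (fun j => norm_charFun_le_one _) fun j => ?_).trans ?_
    · rw [← Complex.ofReal_exp, Complex.norm_real, Real.norm_eq_abs, Real.abs_exp,
        Real.exp_le_one_iff]
      have : 0 ≤ (v : ℝ) * d j ^ 2 / 2 := by positivity
      linarith
    · rw [← tsum_mul_left]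
      refine le_trans (Finset.sum_le_sum fun j _ => ?_)
        ((hsq.mul_left ε).sum_le_tsum s fun j _ => by positivity)
      have := hball (y := d j) (by rw [Real.dist_eq, sub_zero]; exact hsmall j)
      rwa [Real.norm_of_nonneg (sq_nonneg _)] at this
  have hl1 : Tendsto (fun s : Finset ℤ =>
      ∫ ω, Complex.exp (((∑ j ∈ s, d j * Z j ω : ℝ) : ℂ) * Complex.I) ∂P) atTop
      (𝓝 (∫ ω, Complex.exp (((∑' j, d j * Z j ω : ℝ) : ℂ) * Complex.I) ∂P)) := by
    refine tendsto_integral_filter_of_dominated_convergence (fun _ => 1)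
      (Eventually.of_forall fun s => ?_) (Eventually.of_forall fun s => ae_of_all _ fun ω => ?_)
      (integrable_const _) ?_
    · have hs : AEMeasurable (fun ω => ∑ j ∈ s, d j * Z j ω) P :=
        Finset.aemeasurable_fun_sum _ fun j _ => (hm j).const_mul _
      exact (by fun_prop : Continuous fun x : ℝ =>
        Complex.exp ((x : ℂ) * Complex.I)).comp_aestronglyMeasurable hs.aestronglyMeasurable
    · exact (Complex.norm_exp_ofReal_mul_I _).le
    · filter_upwards [ae_summable_mul hident (hL2.integrable one_le_two) hd] with ω hω
      exact ((by fun_prop : Continuous fun x : ℝ =>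
        Complex.exp ((x : ℂ) * Complex.I)).tendsto _).comp hω.hasSum
  have hl2 : Tendsto (fun s : Finset ℤ => Complex.exp ((-(v * (∑ j ∈ s, d j ^ 2) / 2) : ℝ) : ℂ))
      atTop (𝓝 (Complex.exp ((-(v * (∑' j, d j ^ 2) / 2) : ℝ) : ℂ))) :=
    ((by fun_prop : Continuous fun x : ℝ =>
      Complex.exp ((-(v * x / 2) : ℝ) : ℂ)).tendsto _).comp hsq.hasSum
  exact le_of_tendsto' (hl1.sub hl2).norm hfin

end WeightedSum

/-! ### Wiener integrals -/

section SquareIntegrable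

variable {Ω : Type*} [MeasurableSpace Ω] {P : Measure Ω}

theorem integral_sq_eq_eLpNorm {f : Ω → ℝ} (hf : MemLp f 2 P) :
    ∫ ω, f ω ^ 2 ∂P = (eLpNorm f 2 P).toReal ^ 2 := by
  rw [← ENNReal.toReal_pow, ← lintegral_enorm_sq_eq,
    integral_eq_lintegral_of_nonneg_ae (ae_of_all _ fun ω => sq_nonneg _)
      (hf.1.aemeasurable.pow_const 2).aestronglyMeasurable]
  congr 1
  refine lintegral_congr fun ω => ?_
  rw [← sq_abs, ENNReal.ofReal_pow (abs_nonneg _), ← Real.enorm_eq_ofReal_abs]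

theorem lintegral_sq_eq_ofReal {f : Ω → ℝ} (hf : MemLp f 2 P) :
    ∫⁻ ω, ‖f ω‖ₑ ^ 2 ∂P = ENNReal.ofReal (∫ ω, f ω ^ 2 ∂P) := by
  rw [integral_sq_eq_eLpNorm hf, lintegral_enorm_sq_eq, ENNReal.ofReal_pow ENNReal.toReal_nonneg,
    ENNReal.ofReal_toReal hf.2.ne]

theorem tendsto_integral_sq {f : ℕ → Ω → ℝ} {g : Ω → ℝ} (hf : ∀ m, MemLp (f m) 2 P)
    (hg : MemLp g 2 P) (h : Tendsto (fun m => eLpNorm (fun ω => f m ω - g ω) 2 P) atTop (𝓝 0)) :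
    Tendsto (fun m => ∫ ω, f m ω ^ 2 ∂P) atTop (𝓝 (∫ ω, g ω ^ 2 ∂P)) := by
  have h1 : Tendsto (fun m => (hf m).toLp (f m)) atTop (𝓝 (hg.toLp g)) :=
    (Lp.tendsto_Lp_iff_tendsto_eLpNorm'' f hf g hg).2 h
  have h2 := (h1.norm).pow 2
  simpa only [Lp.norm_toLp, ← integral_sq_eq_eLpNorm (hf _), ← integral_sq_eq_eLpNorm hg] using h2

end SquareIntegrable

section Wiener

variable {Ω : Type*} [MeasurableSpace Ω] {P : Measure Ω}
  {B : Set ℝ → Ω → ℝ} {v : ℝ≥0}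

theorem memLp_of_hasLaw_gaussianReal {X : Ω → ℝ} {w : ℝ≥0} (hX : HasLaw X (gaussianReal 0 w) P) :
    MemLp X 2 P := by
  have h := memLp_id_gaussianReal (μ := 0) (v := w) 2
  rw [← hX.map_eq] at h
  exact (memLp_map_measure_iff aestronglyMeasurable_id hX.aemeasurable).1 h

theorem integral_sq_of_hasLaw_gaussianReal {X : Ω → ℝ} {w : ℝ≥0}
    (hX : HasLaw X (gaussianReal 0 w) P) : ∫ ω, X ω ^ 2 ∂P = w := by
  have h1 := hX.integral_eq
  rw [integral_id_gaussianReal] at h1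
  have h2 := hX.variance_eq
  rwa [variance_id_gaussianReal, variance_of_integral_eq_zero hX.aemeasurable h1] at h2

namespace IsGaussianRandomMeasure

theorem memLp (hB : IsGaussianRandomMeasure B v P) {A : Set ℝ} (hA : MeasurableSet A) (hA' : volume A < ∞) : MemLp (B A) 2 P :=
  memLp_of_hasLaw_gaussianReal (hB.hasLaw A hA hA')

/-- The prescribed law on the empty set has variance zero, so it is a point mass at zero. -/
theorem empty_ae_eq (hB : IsGaussianRandomMeasure B v P) : B ∅ =ᵐ[P] 0 := by
  have h := hB.hasLaw ∅ MeasurableSet.empty (by simp)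
  simp only [measure_empty, ENNReal.toNNReal_zero, mul_zero, gaussianReal_zero_var] at h
  exact h.ae_eq_of_dirac

/-- Mean square σ-additivity is applied to the sequence `s, t, ∅, ∅, …`, whose partial sums are
almost surely constant from the second on. -/
theorem union_ae_eq (hB : IsGaussianRandomMeasure B v P) {s t : Set ℝ} (hs : MeasurableSet s) (ht : MeasurableSet t)
    (hs' : volume s < ∞) (ht' : volume t < ∞) (hst : Disjoint s t) :
    B (s ∪ t) =ᵐ[P] fun ω => B s ω + B t ω := by
  let A : ℕ → Set ℝ := fun i => if i = 0 then s else if i = 1 then t else ∅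
  have hA : ∀ i, MeasurableSet (A i) := by
    intro i
    simp only [A]
    split_ifs <;> simp [hs, ht]
  have hU : ⋃ i, A i = s ∪ t := by
    ext x
    simp only [Set.mem_iUnion, Set.mem_union, A]
    constructor
    · rintro ⟨i, hi⟩
      split_ifs at hi
      · exact Or.inl hi
      · exact Or.inr hi
      · exact hi.elim
    · rintro (h | h)
      · exact ⟨0, by simpa using h⟩
      · exact ⟨1, by simpa using h⟩
  have hU' : volume (s ∪ t) < ∞ := measure_union_lt_top hs' ht'
  have hd : Pairwise fun i j => Disjoint (A i) (A j) := by
    intro i j hij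
    simp only [A]
    split_ifs with h1 h2 h3 h4 h5 h6 <;> first | omega | exact hst | exact hst.symm | simp
  have h := hB.additive A hA (by rwa [hU]) hd
  rw [hU] at h
  have hconst : ∀ᶠ m in atTop, eLpNorm (fun ω => B (s ∪ t) ω - ∑ i ∈ Finset.range m, B (A i) ω) 2 P
      = eLpNorm (fun ω => B (s ∪ t) ω - (B s ω + B t ω)) 2 P := by
    filter_upwards [eventually_ge_atTop 2] with m hm
    refine eLpNorm_congr_ae ?_
    filter_upwards [hB.empty_ae_eq] with ω hω
    obtain ⟨p, rfl⟩ := Nat.exists_eq_add_of_le hm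
    rw [Finset.sum_range_add]
    have h0 : ∑ i ∈ Finset.range p, B (A (2 + i)) ω = 0 :=
      Finset.sum_eq_zero fun i _ => by
        have : A (2 + i) = ∅ := by
          simp only [A]
          rw [if_neg (by omega), if_neg (by omega)]
        rw [this, hω]; rfl
    rw [h0, add_zero, Finset.sum_range_succ, Finset.sum_range_one]
    simp [A]
  have hz := tendsto_nhds_unique (h.congr' hconst) tendsto_const_nhds
  have hmeas : AEStronglyMeasurable (fun ω => B (s ∪ t) ω - (B s ω + B t ω)) P :=
    (hB.memLp (hs.union ht) hU').1.sub ((hB.memLp hs hs').1.add (hB.memLp ht ht').1)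
  filter_upwards [(eLpNorm_eq_zero_iff hmeas two_ne_zero).1 hz.symm] with ω hω
  exact sub_eq_zero.1 hω

open Classical in
/-- The random measure as an additive set function with values in the operators `ℝ →L[ℝ] L²`. -/
noncomputable def toOperator (hB : IsGaussianRandomMeasure B v P) (A : Set ℝ) :
    ℝ →L[ℝ] Lp ℝ 2 P :=
  if h : MeasurableSet A ∧ volume A < ∞ then
    ContinuousLinearMap.toSpanSingleton ℝ ((memLp_of_hasLaw_gaussianReal
      (hB.hasLaw A h.1 h.2)).toLp (B A))
  else 0

theorem toOperator_apply (hB : IsGaussianRandomMeasure B v P) {A : Set ℝ} (hA : MeasurableSet A)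
    (hA' : volume A < ∞) (c : ℝ) :
    hB.toOperator A c = c • (hB.memLp hA hA').toLp (B A) := by
  rw [toOperator, dif_pos ⟨hA, hA'⟩, ContinuousLinearMap.toSpanSingleton_apply]

/-- With additivity on sets of finite measure, `simpleIntegral` is an instance of
`SimpleFunc.setToSimpleFunc`, and its linearity follows without handling common refinements of level
sets. -/
theorem finMeasAdditive_toOperator (hB : IsGaussianRandomMeasure B v P) :
    FinMeasAdditive volume hB.toOperator := by
  intro s t hs ht hs' ht' hst
  ext1
  rw [add_apply, hB.toOperator_apply hs (lt_top_iff_ne_top.2 hs'),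
    hB.toOperator_apply ht (lt_top_iff_ne_top.2 ht'), hB.toOperator_apply (hs.union ht)
      (measure_union_lt_top (lt_top_iff_ne_top.2 hs') (lt_top_iff_ne_top.2 ht')), ← smul_add,
    ← MemLp.toLp_add]
  congr 1
  exact MemLp.toLp_congr _ _
    (hB.union_ae_eq hs ht (lt_top_iff_ne_top.2 hs') (lt_top_iff_ne_top.2 ht') hst)

theorem coeFn_setToSimpleFunc (hB : IsGaussianRandomMeasure B v P) {φ : SimpleFunc ℝ ℝ}
    (hφ : MemLp φ 2 volume) :
    ((φ.setToSimpleFunc hB.toOperator : Lp ℝ 2 P) : Ω → ℝ) =ᵐ[P] simpleIntegral B φ := by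
  have hterm : ∀ c : ℝ, hB.toOperator (φ ⁻¹' {c}) c =ᵐ[P] fun ω => c * B (φ ⁻¹' {c}) ω := by
    intro c
    -- The level set of zero usually has infinite measure, where nothing is known of `B`; the factor
    -- `c = 0` removes that term on both sides.
    by_cases hc : c = 0
    · subst hc
      filter_upwards [Lp.coeFn_zero ℝ 2 P] with ω hω
      rw [map_zero, hω, zero_mul]
      rfl
    · have hfin := SimpleFunc.measure_preimage_lt_top_of_memLp two_ne_zero ENNReal.ofNat_ne_top φ hφ
        c hc
      rw [hB.toOperator_apply (φ.measurableSet_preimage _) hfin]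
      filter_upwards [Lp.coeFn_smul c ((hB.memLp (φ.measurableSet_preimage {c}) hfin).toLp _),
        (hB.memLp (φ.measurableSet_preimage {c}) hfin).coeFn_toLp] with ω h1 h2
      rw [h1, Pi.smul_apply, h2, smul_eq_mul]
  have hall : ∀ᵐ ω ∂P, ∀ c ∈ φ.range, (hB.toOperator (φ ⁻¹' {c}) c) ω = c * B (φ ⁻¹' {c}) ω :=
    (φ.range.finite_toSet.eventually_all (l := ae P)).2 fun c _ => hterm c
  filter_upwards [hall, Lp.coeFn_finsetSum φ.range fun c => hB.toOperator (φ ⁻¹' {c}) c]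
    with ω h1 h2
  rw [SimpleFunc.setToSimpleFunc, h2, Finset.sum_apply, simpleIntegral]
  exact Finset.sum_congr rfl h1

theorem memLp_simpleIntegral (hB : IsGaussianRandomMeasure B v P) {φ : SimpleFunc ℝ ℝ}
    (hφ : MemLp φ 2 volume) : MemLp (simpleIntegral B φ) 2 P :=
  (Lp.memLp _).ae_eq (hB.coeFn_setToSimpleFunc hφ)

theorem simpleIntegral_add (hB : IsGaussianRandomMeasure B v P) {φ ψ : SimpleFunc ℝ ℝ}
    (hφ : MemLp φ 2 volume) (hψ : MemLp ψ 2 volume) :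
    simpleIntegral B (φ + ψ) =ᵐ[P] fun ω => simpleIntegral B φ ω + simpleIntegral B ψ ω := by
  have hi : ∀ {χ : SimpleFunc ℝ ℝ}, MemLp χ 2 volume → Integrable χ volume := fun h =>
    (SimpleFunc.memLp_iff_integrable two_ne_zero ENNReal.ofNat_ne_top).1 h
  have hs : MemLp (φ + ψ : SimpleFunc ℝ ℝ) 2 volume := by
    rw [SimpleFunc.coe_add]; exact hφ.add hψ
  have h := SimpleFunc.setToSimpleFunc_add _ hB.finMeasAdditive_toOperator (hi hφ) (hi hψ)
  filter_upwards [hB.coeFn_setToSimpleFunc hs, hB.coeFn_setToSimpleFunc hφ,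
    hB.coeFn_setToSimpleFunc hψ, Lp.coeFn_add (φ.setToSimpleFunc hB.toOperator)
      (ψ.setToSimpleFunc hB.toOperator)] with ω h1 h2 h3 h4
  rw [← h1, h, h4, Pi.add_apply, h2, h3]

theorem simpleIntegral_smul (hB : IsGaussianRandomMeasure B v P) (c : ℝ) {φ : SimpleFunc ℝ ℝ}
    (hφ : MemLp φ 2 volume) :
    simpleIntegral B (c • φ) =ᵐ[P] fun ω => c * simpleIntegral B φ ω := by
  have hi := (SimpleFunc.memLp_iff_integrable two_ne_zero ENNReal.ofNat_ne_top).1 hφ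
  have hs : MemLp (c • φ : SimpleFunc ℝ ℝ) 2 volume := by
    rw [SimpleFunc.coe_smul]; exact hφ.const_smul c
  have h := SimpleFunc.setToSimpleFunc_smul_real _ hB.finMeasAdditive_toOperator c hi
  filter_upwards [hB.coeFn_setToSimpleFunc hs, hB.coeFn_setToSimpleFunc hφ,
    Lp.coeFn_smul c (φ.setToSimpleFunc hB.toOperator)] with ω h1 h2 h3
  rw [← h1, h, h3, Pi.smul_apply, h2, smul_eq_mul]

/-- The level sets of the nonzero values are disjoint and of finite measure, so the integral is a
sum of independent centred Gaussian variables whose variances add up to `v ∫ φ²`. -/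
theorem charFun_simpleIntegral (hB : IsGaussianRandomMeasure B v P) {φ : SimpleFunc ℝ ℝ}
    (hφ : MemLp φ 2 volume) (θ : ℝ) :
    charFun (P.map (simpleIntegral B φ)) θ =
      Complex.exp ((-(v * (∫ y, φ y ^ 2) * θ ^ 2 / 2) : ℝ) : ℂ) := by
  classical
  set S := φ.range.filter (· ≠ 0) with hS
  have hfin : ∀ c ∈ S, volume (φ ⁻¹' {c}) < ∞ := fun c hc =>
    SimpleFunc.measure_preimage_lt_top_of_memLp two_ne_zero ENNReal.ofNat_ne_top φ hφ c
      (Finset.mem_filter.1 hc).2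
  let e : Fin S.card ≃ S := S.equivFin.symm
  have hind := hB.indep S.card (fun i => φ ⁻¹' {(e i : ℝ)})
    (fun i => φ.measurableSet_preimage _) (fun i => hfin _ (e i).2) (by
      intro i j hij
      refine Set.disjoint_left.2 fun x hx hx' => hij (e.injective (Subtype.ext ?_))
      exact (Set.mem_singleton_iff.1 hx).symm.trans (Set.mem_singleton_iff.1 hx'))
  have hind' : iIndepFun (fun i ω => (e i : ℝ) * B (φ ⁻¹' {(e i : ℝ)}) ω) P :=
    hind.comp (fun i x => (e i : ℝ) * x) fun i => measurable_const_mul _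
  have hm : ∀ i, AEMeasurable (B (φ ⁻¹' {(e i : ℝ)})) P := fun i =>
    (hB.hasLaw _ (φ.measurableSet_preimage _) (hfin _ (e i).2)).aemeasurable
  have hsum : simpleIntegral B φ = fun ω => ∑ i, (e i : ℝ) * B (φ ⁻¹' {(e i : ℝ)}) ω := by
    funext ω
    rw [e.sum_comp fun c : S => (c : ℝ) * B (φ ⁻¹' {(c : ℝ)}) ω,
      Finset.sum_coe_sort S fun c => c * B (φ ⁻¹' {c}) ω, simpleIntegral, hS,
      Finset.sum_filter_of_ne]
    intro c _ hc h0
    rw [h0, zero_mul] at hc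
    exact hc rfl
  have hint : ∫ y, φ y ^ 2 = ∑ i, (e i : ℝ) ^ 2 * (volume (φ ⁻¹' {(e i : ℝ)})).toReal := by
    have h1 : ∫ y, φ y ^ 2 = ∑ c ∈ φ.range, volume.real (φ ⁻¹' {c}) • c ^ 2 := by
      have hi := (SimpleFunc.memLp_iff_integrable two_ne_zero ENNReal.ofNat_ne_top).1 hφ
      rw [← SimpleFunc.map_integral φ (fun c => c ^ 2) hi (by norm_num),
        SimpleFunc.integral_eq_integral]
      · rfl
      · exact hφ.integrable_sq
    rw [h1, e.sum_comp fun c : S => (c : ℝ) ^ 2 * (volume (φ ⁻¹' {(c : ℝ)})).toReal,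
      Finset.sum_coe_sort S fun c => c ^ 2 * (volume (φ ⁻¹' {c})).toReal, hS,
      Finset.sum_filter_of_ne]
    · exact Finset.sum_congr rfl fun c _ => by rw [smul_eq_mul, mul_comm]; rfl
    · intro c _ hc h0
      rw [h0] at hc
      simp at hc
  rw [hsum, hind'.charFun_map_fun_sum_eq_prod fun i => (hm i).const_mul _, Finset.prod_apply]
  have hterm : ∀ i, charFun (P.map fun ω => (e i : ℝ) * B (φ ⁻¹' {(e i : ℝ)}) ω) θ =
      Complex.exp ((-(v * ((e i : ℝ) ^ 2 * (volume (φ ⁻¹' {(e i : ℝ)})).toReal) * θ ^ 2 / 2) : ℝ)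
        : ℂ) := by
    intro i
    rw [charFun_map_mul_comp (hm i),
      (hB.hasLaw _ (φ.measurableSet_preimage _) (hfin _ (e i).2)).map_eq, charFun_gaussianReal]
    congr 1
    push_cast
    rw [← ENNReal.coe_toNNReal_eq_toReal]
    ring
  rw [Finset.prod_congr rfl fun i _ => hterm i, ← Complex.exp_sum, ← Complex.ofReal_sum, hint,
    Finset.mul_sum, Finset.sum_mul, Finset.sum_div, Finset.sum_neg_distrib]

theorem hasLaw_of_charFun [IsProbabilityMeasure P] {X : Ω → ℝ} (hX : AEMeasurable X P) {w : ℝ} (hw : 0 ≤ w)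
    (h : ∀ θ : ℝ, charFun (P.map X) θ = Complex.exp ((-(w * θ ^ 2 / 2) : ℝ) : ℂ)) :
    HasLaw X (gaussianReal 0 w.toNNReal) P := by
  refine ⟨hX, ?_⟩
  have : IsProbabilityMeasure (P.map X) := Measure.isProbabilityMeasure_map hX
  refine Measure.ext_of_charFun (funext fun θ => ?_)
  rw [h, charFun_gaussianReal]
  congr 1
  push_cast
  rw [Real.coe_toNNReal _ hw]
  ring

/-- A Wiener integral is a centred Gaussian random variable. -/
theorem hasLaw_wienerIntegral [IsProbabilityMeasure P] (hB : IsGaussianRandomMeasure B v P) {f : ℝ → ℝ} {X : Ω → ℝ}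
    (h : IsWienerIntegral B P f X) :
    HasLaw X (gaussianReal 0 (v * ∫ y, f y ^ 2 : ℝ).toNNReal) P := by
  obtain ⟨hf, hX, φ, hφ, hφf, hφX⟩ := h
  refine hasLaw_of_charFun hX.1.aemeasurable
    (mul_nonneg v.coe_nonneg (integral_nonneg fun _ => sq_nonneg _)) fun θ => ?_
  have hI := fun m => hB.memLp_simpleIntegral (hφ m)
  -- Mean square convergence implies convergence in law, so the Gaussian characteristic functions of
  -- the simple integrals converge to that of `X`, while their variances converge by
  -- `tendsto_integral_sq`.
  have h1 : TendstoInDistribution (fun m => simpleIntegral B (φ m)) atTop X (fun _ => P) P :=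
    (tendstoInMeasure_of_tendsto_eLpNorm two_ne_zero (fun m => (hI m).1) hX.1
      hφX).tendstoInDistribution fun m => (hI m).1.aemeasurable
  have h2 := ProbabilityMeasure.tendsto_iff_tendsto_charFun.1 h1.tendsto θ
  simp only [ProbabilityMeasure.coe_mk, hB.charFun_simpleIntegral (hφ _)] at h2
  refine tendsto_nhds_unique h2 ?_
  have h3 := tendsto_integral_sq hφ hf hφf
  exact ((by fun_prop : Continuous fun x : ℝ =>
    Complex.exp ((-(v * x * θ ^ 2 / 2) : ℝ) : ℂ)).tendsto _).comp h3

theorem lintegral_wienerIntegral_sq [IsProbabilityMeasure P] (hB : IsGaussianRandomMeasure B v P) {f : ℝ → ℝ} {X : Ω → ℝ}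
    (h : IsWienerIntegral B P f X) :
    ∫⁻ ω, ‖X ω‖ₑ ^ 2 ∂P = ENNReal.ofReal (v * ∫ y, f y ^ 2) := by
  rw [lintegral_sq_eq_ofReal h.2.1, integral_sq_of_hasLaw_gaussianReal (hB.hasLaw_wienerIntegral h),
    Real.coe_toNNReal _ (mul_nonneg v.coe_nonneg (integral_nonneg fun _ => sq_nonneg _))]

theorem integral_exp_wienerIntegral [IsProbabilityMeasure P] (hB : IsGaussianRandomMeasure B v P) {f : ℝ → ℝ} {X : Ω → ℝ}
    (h : IsWienerIntegral B P f X) :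
    ∫ ω, Complex.exp ((X ω : ℂ) * Complex.I) ∂P =
      Complex.exp ((-(v * (∫ y, f y ^ 2) / 2) : ℝ) : ℂ) := by
  have hl := hB.hasLaw_wienerIntegral h
  have h1 : charFun (P.map X) 1 = ∫ ω, Complex.exp ((X ω : ℂ) * Complex.I) ∂P := by
    rw [charFun_apply_real, integral_map hl.aemeasurable (by fun_prop)]
    simp
  rw [← h1, hl.map_eq, charFun_gaussianReal]
  congr 1
  push_cast
  rw [Real.coe_toNNReal _ (mul_nonneg v.coe_nonneg (integral_nonneg fun _ => sq_nonneg _))]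
  push_cast
  ring

/-! ### Linearity, isometry and existence of the Wiener integral -/

theorem isWienerIntegral_add (hB : IsGaussianRandomMeasure B v P) {f g : ℝ → ℝ} {X Y : Ω → ℝ}
    (hX : IsWienerIntegral B P f X) (hY : IsWienerIntegral B P g Y) :
    IsWienerIntegral B P (fun y => f y + g y) fun ω => X ω + Y ω := by
  obtain ⟨hf, hX, φ, hφ, hφf, hφX⟩ := hX
  obtain ⟨hg, hY, ψ, hψ, hψg, hψY⟩ := hY
  refine ⟨hf.add hg, hX.add hY, fun m => φ m + ψ m, fun m => ?_, ?_, ?_⟩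
  · rw [SimpleFunc.coe_add]; exact (hφ m).add (hψ m)
  · refine tendsto_of_tendsto_of_tendsto_of_le_of_le tendsto_const_nhds
      (by simpa using hφf.add hψg) (fun _ => zero_le) fun m => ?_
    have e : (fun y => (φ m + ψ m) y - (f y + g y)) =
        (fun y => φ m y - f y) + fun y => ψ m y - g y := by
      funext y; simp; ring
    rw [e]
    exact eLpNorm_add_le ((hφ m).1.sub hf.1) ((hψ m).1.sub hg.1) one_le_two
  · refine tendsto_of_tendsto_of_tendsto_of_le_of_le tendsto_const_nhds
      (by simpa using hφX.add hψY) (fun _ => zero_le) fun m => ?_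
    have e : (fun ω => simpleIntegral B (φ m + ψ m) ω - (X ω + Y ω)) =ᵐ[P]
        (fun ω => simpleIntegral B (φ m) ω - X ω) + fun ω => simpleIntegral B (ψ m) ω - Y ω := by
      filter_upwards [hB.simpleIntegral_add (hφ m) (hψ m)] with ω hω
      rw [hω, Pi.add_apply]; ring
    rw [eLpNorm_congr_ae e]
    exact eLpNorm_add_le ((hB.memLp_simpleIntegral (hφ m)).1.sub hX.1)
      ((hB.memLp_simpleIntegral (hψ m)).1.sub hY.1) one_le_two

theorem isWienerIntegral_const_mul (hB : IsGaussianRandomMeasure B v P) (c : ℝ) {f : ℝ → ℝ}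
    {X : Ω → ℝ} (hX : IsWienerIntegral B P f X) :
    IsWienerIntegral B P (fun y => c * f y) fun ω => c * X ω := by
  obtain ⟨hf, hX, φ, hφ, hφf, hφX⟩ := hX
  refine ⟨hf.const_mul c, hX.const_mul c, fun m => c • φ m, fun m => ?_, ?_, ?_⟩
  · rw [SimpleFunc.coe_smul]; exact (hφ m).const_smul c
  · have e : ∀ m, (fun y => (c • φ m) y - c * f y) = c • fun y => φ m y - f y := by
      intro m; funext y; simp; ring
    simp only [e, eLpNorm_const_smul]
    simpa using ENNReal.Tendsto.const_mul hφf (Or.inr enorm_ne_top)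
  · have e : ∀ m, (fun ω => simpleIntegral B (c • φ m) ω - c * X ω) =ᵐ[P]
        c • fun ω => simpleIntegral B (φ m) ω - X ω := by
      intro m
      filter_upwards [hB.simpleIntegral_smul c (hφ m)] with ω hω
      rw [hω, Pi.smul_apply, smul_eq_mul]; ring
    simp only [eLpNorm_congr_ae (e _), eLpNorm_const_smul]
    simpa using ENNReal.Tendsto.const_mul hφX (Or.inr enorm_ne_top)

theorem isWienerIntegral_zero (B : Set ℝ → Ω → ℝ) (P : Measure Ω) :
    IsWienerIntegral B P (fun _ => 0) fun _ => 0 := by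
  refine ⟨MemLp.zero', MemLp.zero', fun _ => 0, fun _ => ?_, ?_, ?_⟩
  · rw [SimpleFunc.coe_zero]; exact MemLp.zero
  · simp
  · have e : simpleIntegral B 0 = fun _ : Ω => (0 : ℝ) := by
      funext ω
      refine Finset.sum_eq_zero fun c hc => ?_
      obtain ⟨x, hx⟩ := SimpleFunc.mem_range.1 hc
      have : c = 0 := hx.symm
      rw [this, zero_mul]
    simp [e]

theorem isWienerIntegral_finsetSum (hB : IsGaussianRandomMeasure B v P) {ι : Type*} (s : Finset ι)
    (a : ι → ℝ) {f : ι → ℝ → ℝ} {X : ι → Ω → ℝ} (h : ∀ i, IsWienerIntegral B P (f i) (X i)) :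
    IsWienerIntegral B P (fun y => ∑ i ∈ s, a i * f i y) fun ω => ∑ i ∈ s, a i * X i ω := by
  classical
  induction s using Finset.induction_on with
  | empty => simpa using isWienerIntegral_zero B P
  | insert i s hi ih =>
    simp only [Finset.sum_insert hi]
    exact hB.isWienerIntegral_add (hB.isWienerIntegral_const_mul (a i) (h i)) ih

theorem simpleFunc_isWienerIntegral (hB : IsGaussianRandomMeasure B v P) {φ : SimpleFunc ℝ ℝ}
    (hφ : MemLp φ 2 volume) : IsWienerIntegral B P φ (simpleIntegral B φ) :=
  ⟨hφ, hB.memLp_simpleIntegral hφ, fun _ => φ, fun _ => hφ, by simp, by simp⟩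

theorem eLpNorm_wienerIntegral [IsProbabilityMeasure P] (hB : IsGaussianRandomMeasure B v P) {f : ℝ → ℝ} {X : Ω → ℝ}
    (h : IsWienerIntegral B P f X) :
    eLpNorm X 2 P = ENNReal.ofReal (Real.sqrt v) * eLpNorm f 2 volume := by
  have h1 := hB.lintegral_wienerIntegral_sq h
  rw [ENNReal.ofReal_mul v.coe_nonneg, ← lintegral_sq_eq_ofReal h.1, lintegral_enorm_sq_eq,
    lintegral_enorm_sq_eq, ← Real.sq_sqrt v.coe_nonneg, ENNReal.ofReal_pow (Real.sqrt_nonneg _),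
    ← mul_pow] at h1
  exact (ENNReal.pow_right_strictMono two_ne_zero).injective h1

theorem exists_isWienerIntegral [IsProbabilityMeasure P] (hB : IsGaussianRandomMeasure B v P) {f : ℝ → ℝ}
    (hf : MemLp f 2 volume) : ∃ X, IsWienerIntegral B P f X := by
  choose φ hφ hφm using fun m : ℕ => hf.exists_simpleFunc_eLpNorm_sub_lt ENNReal.ofNat_ne_top
    (ε := ENNReal.ofReal ((1 / 2) ^ m)) (by simp)
  have hφf : Tendsto (fun m => eLpNorm (fun y => φ m y - f y) 2 volume) atTop (𝓝 0) := by
    refine tendsto_of_tendsto_of_tendsto_of_le_of_le tendsto_const_nhds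
      (h := fun m : ℕ => ENNReal.ofReal ((1 / 2) ^ m)) ?_ (fun _ => zero_le) fun m => ?_
    · simpa using ENNReal.tendsto_ofReal
        (tendsto_pow_atTop_nhds_zero_of_lt_one (by norm_num : (0 : ℝ) ≤ 1 / 2) (by norm_num))
    · change eLpNorm (⇑(φ m) - f) 2 volume ≤ _
      rw [eLpNorm_sub_comm]
      exact (hφ m).le
  have hI := fun m => hB.memLp_simpleIntegral (hφm m)
  -- Beyond index `N` both integrands are within `(1/2)^N` of `f`, so the isometry bounds the
  -- distance of the integrals by `√v * 2 * (1/2)^N`. The extra `1` gives strictness, also for `v =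
  -- 0`.
  obtain ⟨X, hX, hlim⟩ := Lp.cauchy_complete_eLpNorm (p := 2) one_le_two hI
    (B := fun m => ENNReal.ofReal ((Real.sqrt v * 2 + 1) * (1 / 2) ^ m)) (by
      have hs : Summable fun m : ℕ => (Real.sqrt v * 2 + 1) * (1 / 2 : ℝ) ^ m :=
        (summable_geometric_of_lt_one (by norm_num) (by norm_num)).mul_left _
      rw [← ENNReal.ofReal_tsum_of_nonneg (fun m => by positivity) hs]
      exact ENNReal.ofReal_ne_top) (by
      intro N n m hn hm
      have h1 := hB.isWienerIntegral_add (hB.simpleFunc_isWienerIntegral (hφm n))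
        (hB.isWienerIntegral_const_mul (-1) (hB.simpleFunc_isWienerIntegral (hφm m)))
      have e : (simpleIntegral B (φ n) - simpleIntegral B (φ m)) =
          fun ω => simpleIntegral B (φ n) ω + -1 * simpleIntegral B (φ m) ω := by
        funext ω; simp [sub_eq_add_neg]
      rw [e, hB.eLpNorm_wienerIntegral h1]
      have e' : (fun y => φ n y + -1 * φ m y) = (f - ⇑(φ m)) - (f - ⇑(φ n)) := by
        funext y; simp; ring
      have hbound : ∀ k, N ≤ k → eLpNorm (f - ⇑(φ k)) 2 volume ≤ ENNReal.ofReal ((1 / 2) ^ N) :=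
        fun k hk => (hφ k).le.trans (ENNReal.ofReal_le_ofReal
          (pow_le_pow_of_le_one (by norm_num) (by norm_num) hk))
      rw [e']
      refine lt_of_le_of_lt (mul_le_mul_right ((eLpNorm_sub_le (hf.1.sub (hφm m).1)
        (hf.1.sub (hφm n).1) one_le_two).trans (add_le_add (hbound m hm) (hbound n hn))) _) ?_
      rw [← ENNReal.ofReal_add (by positivity) (by positivity),
        ← ENNReal.ofReal_mul (Real.sqrt_nonneg _),
        ENNReal.ofReal_lt_ofReal_iff (by positivity)]
      have : (0 : ℝ) < (1 / 2) ^ N := by positivity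
      nlinarith)
  exact ⟨X, hf, hX, φ, hφm, hφf, hlim⟩

end IsGaussianRandomMeasure

end Wiener

/-! ### Estimates for integrals of power kernels -/

section PowerKernel

theorem temperedPower_nonneg (p lam x : ℝ) : 0 ≤ temperedPower p lam x := by
  unfold temperedPower
  split_ifs with h
  · positivity
  · exact le_rfl

theorem measurable_temperedPower (p lam : ℝ) : Measurable (temperedPower p lam) :=
  Measurable.ite measurableSet_Ioi (by fun_prop) measurable_const

theorem temperedPower_zero_of_pos (p : ℝ) {x : ℝ} (hx : 0 < x) : temperedPower p 0 x = x ^ p := by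
  rw [temperedPower, if_pos hx, zero_mul, neg_zero, Real.exp_zero, mul_one]

theorem temperedPower_of_nonpos (p lam : ℝ) {x : ℝ} (hx : x ≤ 0) : temperedPower p lam x = 0 :=
  if_neg hx.not_gt

theorem exists_rpow_mul_exp_le {s lam : ℝ} (hs : 0 ≤ s) (hlam : 0 < lam) :
    ∃ K : ℝ, 0 ≤ K ∧ ∀ u : ℝ, 0 < u → u ^ s * Real.exp (-(lam * u)) ≤ K := by
  set k := ⌈s⌉₊
  -- The constant comes from `u^s ≤ 1 + u^k` with `k = ⌈s⌉` and from `(lam u)^k / k! ≤ e^(lam u)`.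
  refine ⟨1 + k.factorial / lam ^ k, by positivity, fun u hu => ?_⟩
  have h1 : u ^ s ≤ 1 + u ^ k := by
    rcases le_total u 1 with h | h
    · have := Real.rpow_le_one hu.le h hs
      have : 0 < u ^ k := by positivity
      linarith
    · have := Real.rpow_le_rpow_of_exponent_le h (Nat.le_ceil s)
      rw [Real.rpow_natCast] at this
      linarith
  have h2 : u ^ k * Real.exp (-(lam * u)) ≤ k.factorial / lam ^ k := by
    have h := Real.pow_div_factorial_le_exp (lam * u) (by positivity) k
    rw [div_le_iff₀ (by positivity), mul_pow] at h
    rw [le_div_iff₀ (by positivity), Real.exp_neg, ← div_eq_mul_inv, div_mul_eq_mul_div,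
      div_le_iff₀ (Real.exp_pos _)]
    linarith
  have h3 : Real.exp (-(lam * u)) ≤ 1 := Real.exp_le_one_iff.2 (by
    have : 0 < lam * u := by positivity
    linarith)
  calc u ^ s * Real.exp (-(lam * u)) ≤ (1 + u ^ k) * Real.exp (-(lam * u)) := by gcongr
    _ = Real.exp (-(lam * u)) + u ^ k * Real.exp (-(lam * u)) := by ring
    _ ≤ _ := add_le_add h3 h2

/-- The exponential absorbs the surplus power `u^(α-β)`. What remains, `u^(β-1)`, is nonincreasing
because `β ≤ 1`, so `u` may be replaced by its lower bound `x / 2`. This slack lets the same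
constant serve the exact distance `s - y` and its grid version. -/
theorem exists_temperedPower_le {α β lam : ℝ} (hβ : β ≤ α) (hβ1 : β ≤ 1) (hlam : 0 < lam) :
    ∃ K : ℝ, 0 ≤ K ∧ ∀ u x : ℝ, (0 < u → 0 < x ∧ x / 2 ≤ u) →
      |temperedPower (α - 1) lam u| ≤ K * temperedPower (β - 1) 0 x := by
  obtain ⟨K, hK, hbound⟩ := exists_rpow_mul_exp_le (sub_nonneg.2 hβ) hlam
  refine ⟨K * (1 / 2) ^ (β - 1), by positivity, fun u x h => ?_⟩
  rw [abs_of_nonneg (temperedPower_nonneg _ _ _)]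
  rcases le_or_gt u 0 with hu | hu
  · rw [temperedPower_of_nonpos _ _ hu]
    exact mul_nonneg (by positivity) (temperedPower_nonneg _ _ _)
  · obtain ⟨hx, hxu⟩ := h hu
    rw [temperedPower_zero_of_pos _ hx, temperedPower, if_pos hu]
    have e : u ^ (α - 1) = u ^ (α - β) * u ^ (β - 1) := by
      rw [← Real.rpow_add hu]; congr 1; ring
    have h1 : u ^ (β - 1) ≤ (1 / 2) ^ (β - 1) * x ^ (β - 1) := by
      rw [← Real.mul_rpow (by norm_num) hx.le]
      exact Real.rpow_le_rpow_of_nonpos (by positivity) (by linarith) (by linarith)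
    calc u ^ (α - 1) * Real.exp (-(lam * u))
        = u ^ (α - β) * Real.exp (-(lam * u)) * u ^ (β - 1) := by rw [e]; ring
      _ ≤ K * ((1 / 2) ^ (β - 1) * x ^ (β - 1)) :=
          mul_le_mul (hbound u hu) h1 (by positivity) hK
      _ = _ := by ring

/-- The antiderivative `(x)_+^β / β` of `(x)_+^(β-1)`. -/
noncomputable def posPower (β x : ℝ) : ℝ := (max x 0) ^ β / β

theorem posPower_of_nonpos {β x : ℝ} (hβ : 0 < β) (hx : x ≤ 0) : posPower β x = 0 := by
  rw [posPower, max_eq_right hx, Real.zero_rpow hβ.ne', zero_div]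

theorem posPower_mono {β : ℝ} (hβ : 0 < β) : Monotone (posPower β) := by
  intro x y h
  unfold posPower
  gcongr

theorem measurable_posPower (β : ℝ) : Measurable (posPower β) := by
  unfold posPower
  fun_prop

theorem intervalIntegrable_power {β : ℝ} (hβ : 0 < β) (a b : ℝ) :
    IntervalIntegrable (temperedPower (β - 1) 0) volume a b := by
  have h := intervalIntegral.intervalIntegrable_rpow' (a := a) (b := b) (r := β - 1) (by linarith)
  refine h.mono_fun (measurable_temperedPower _ _).aestronglyMeasurable
    (ae_of_all _ fun x => ?_)
  change ‖temperedPower (β - 1) 0 x‖ ≤ ‖x ^ (β - 1)‖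
  rcases le_or_gt x 0 with hx | hx
  · rw [temperedPower_of_nonpos _ _ hx, norm_zero]; exact norm_nonneg _
  · rw [temperedPower_zero_of_pos _ hx]

theorem integral_power_zero {β : ℝ} (hβ : 0 < β) (x : ℝ) :
    ∫ s in (0 : ℝ)..x, temperedPower (β - 1) 0 s = posPower β x := by
  rcases le_or_gt x 0 with hx | hx
  · rw [posPower_of_nonpos hβ hx]
    refine intervalIntegral.integral_zero_ae (ae_of_all _ fun s hs => ?_)
    rw [Set.uIoc_of_ge hx] at hs
    exact temperedPower_of_nonpos _ _ hs.2
  · have e : ∫ s in (0 : ℝ)..x, temperedPower (β - 1) 0 s = ∫ s in (0 : ℝ)..x, s ^ (β - 1) := by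
      refine intervalIntegral.integral_congr_ae (ae_of_all _ fun s hs => ?_)
      rw [Set.uIoc_of_le hx.le] at hs
      exact temperedPower_zero_of_pos _ hs.1
    rw [e, integral_rpow (Or.inl (by linarith)), sub_add_cancel, Real.zero_rpow hβ.ne', sub_zero,
      posPower, max_eq_left hx.le]

theorem intervalIntegrable_power_sub {β : ℝ} (hβ : 0 < β) (a b y : ℝ) :
    IntervalIntegrable (fun s => temperedPower (β - 1) 0 (s - y)) volume a b := by
  have := (intervalIntegrable_power hβ (a - y) (b - y)).comp_sub_right y
  simpa using this

theorem integral_power_sub {β : ℝ} (hβ : 0 < β) (a b y : ℝ) :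
    ∫ s in a..b, temperedPower (β - 1) 0 (s - y) = posPower β (b - y) - posPower β (a - y) := by
  rw [intervalIntegral.integral_comp_sub_right (fun s => temperedPower (β - 1) 0 s),
    ← integral_power_zero hβ, ← integral_power_zero hβ,
    intervalIntegral.integral_interval_sub_left (intervalIntegrable_power hβ _ _)
      (intervalIntegrable_power hβ _ _)]

/-- Subadditivity of `x ↦ x^β`. This bound serves near the singularity; the linear bound in `h`,
from Bernoulli's inequality, serves for `x > h`. -/
theorem posPower_add_sub_le {β h : ℝ} (hβ : 0 < β) (hβ1 : β ≤ 1) (hh : 0 ≤ h) (x : ℝ) :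
    posPower β (h + x) - posPower β x ≤ h ^ β / β := by
  have h1 : (max (h + x) 0) ^ β ≤ (max x 0 + h) ^ β := by
    refine Real.rpow_le_rpow (le_max_right _ _) (max_le ?_ (by positivity)) hβ.le
    linarith [le_max_left x 0]
  have h2 := Real.rpow_add_le_add_rpow (le_max_right x 0) hh hβ.le hβ1
  unfold posPower
  rw [← sub_div]
  gcongr
  linarith

theorem posPower_add_sub_le_of_pos {β h x : ℝ} (hβ : 0 < β) (hβ1 : β ≤ 1) (hh : 0 ≤ h)
    (hx : 0 < x) : posPower β (h + x) - posPower β x ≤ h * x ^ (β - 1) := by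
  have h1 : (h + x) ^ β ≤ x ^ β + β * h * x ^ (β - 1) := by
    have e : h + x = x * (1 + h / x) := by field_simp; ring
    have h2 := rpow_one_add_le_one_add_mul_self (s := h / x)
      (by have : 0 ≤ h / x := by positivity
          linarith) hβ.le hβ1
    rw [e, Real.mul_rpow hx.le (by positivity)]
    calc x ^ β * (1 + h / x) ^ β ≤ x ^ β * (1 + β * (h / x)) := by gcongr
      _ = x ^ β + β * h * x ^ (β - 1) := by
          rw [Real.rpow_sub_one hx.ne']; field_simp
  unfold posPower
  rw [max_eq_left hx.le, max_eq_left (by positivity), ← sub_div, div_le_iff₀ hβ]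
  nlinarith

/-- After the substitution `x = a - y` the integrand vanishes for `x ≤ -h`. The interval `(-h, h]`
contributes length `2h` times `(h^β/β)²`. Beyond `h` the linear bound contributes `h² ∫ x^(2β-2) =
h^(1+2β) / (1-2β)`, which converges because `β < 1/2`. -/
theorem lintegral_posPower_increment_le {β : ℝ} (hβ : 0 < β) (hβ1 : β < 1 / 2) :
    ∃ c : ℝ, 0 ≤ c ∧ ∀ a b : ℝ, a ≤ b →
      ∫⁻ y, ENNReal.ofReal ((posPower β (b - y) - posPower β (a - y)) ^ 2) ≤
        ENNReal.ofReal (c * (b - a) ^ (1 + 2 * β)) := by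
  refine ⟨2 * (1 / β) ^ 2 + 1 / (1 - 2 * β),
    add_nonneg (by positivity) (div_nonneg zero_le_one (by linarith)), fun a b hab => ?_⟩
  rcases hab.eq_or_lt with rfl | hlt
  · simp
  set h := b - a with hh
  have hpos : 0 < h := sub_pos.2 hlt
  have e : ∀ y, ENNReal.ofReal ((posPower β (b - y) - posPower β (a - y)) ^ 2) =
      (fun x => ENNReal.ofReal ((posPower β (h + x) - posPower β x) ^ 2)) (a - y) := by
    intro y
    simp only [hh]
    congr 5
    ring
  simp only [e]
  rw [lintegral_sub_left_eq_self (fun x =>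
    ENNReal.ofReal ((posPower β (h + x) - posPower β x) ^ 2)) a]
  have hpt : ∀ x, ENNReal.ofReal ((posPower β (h + x) - posPower β x) ^ 2) ≤
      (Set.Ioc (-h) h).indicator (fun _ => ENNReal.ofReal ((h ^ β / β) ^ 2)) x +
      (Set.Ioi h).indicator (fun x => ENNReal.ofReal (h ^ 2 * x ^ (2 * β - 2))) x := by
    intro x
    have hnn : 0 ≤ posPower β (h + x) - posPower β x :=
      sub_nonneg.2 (posPower_mono hβ (by linarith))
    rcases le_or_gt x (-h) with h1 | h1
    · rw [posPower_of_nonpos hβ (by linarith), posPower_of_nonpos hβ (by linarith)]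
      simp
    · rcases le_or_gt x h with h2 | h2
      · rw [Set.indicator_of_mem (s := Set.Ioc (-h) h) ⟨h1, h2⟩]
        refine le_add_right (ENNReal.ofReal_le_ofReal ?_)
        exact pow_le_pow_left₀ hnn (posPower_add_sub_le hβ (by linarith) hpos.le x) 2
      · rw [Set.indicator_of_mem (s := Set.Ioi h) h2]
        refine le_add_left (ENNReal.ofReal_le_ofReal ?_)
        have hx : 0 < x := hpos.trans h2
        refine (pow_le_pow_left₀ hnn (posPower_add_sub_le_of_pos hβ (by linarith) hpos.le hx)
          2).trans (le_of_eq ?_)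
        rw [mul_pow, ← Real.rpow_natCast (x ^ (β - 1)), ← Real.rpow_mul hx.le]
        congr 2
        push_cast; ring
  refine (lintegral_mono hpt).trans ?_
  rw [lintegral_add_left (measurable_const.indicator measurableSet_Ioc),
    lintegral_indicator_const measurableSet_Ioc, lintegral_indicator measurableSet_Ioi,
    Real.volume_Ioc, ← ENNReal.ofReal_mul (by positivity),
    ← ofReal_integral_eq_lintegral_ofReal
      ((integrableOn_Ioi_rpow_of_lt (by linarith) hpos).const_mul _)
      ((ae_restrict_iff' measurableSet_Ioi).2 (ae_of_all _ fun x hx =>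
        mul_nonneg (sq_nonneg _) (Real.rpow_nonneg (hpos.le.trans (le_of_lt hx)) _))),
    integral_const_mul, integral_Ioi_rpow_of_lt (by linarith) hpos, ← ENNReal.ofReal_add
      (mul_nonneg (sq_nonneg _) (by linarith)) (mul_nonneg (sq_nonneg _) (by
        rw [neg_div, ← div_neg]
        exact div_nonneg (Real.rpow_nonneg hpos.le _) (by linarith)))]
  refine ENNReal.ofReal_le_ofReal (le_of_eq ?_)
  have e1 : h ^ (1 + 2 * β) = h * (h ^ β) ^ 2 := by
    rw [Real.rpow_add hpos, Real.rpow_one, ← Real.rpow_natCast, ← Real.rpow_mul hpos.le]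
    congr 2; push_cast; ring
  have e2 : h ^ 2 * h ^ (2 * β - 2 + 1) = h ^ (1 + 2 * β) := by
    rw [← Real.rpow_natCast, ← Real.rpow_add hpos]
    congr 1; push_cast; ring
  have hne : (1 - 2 * β) ≠ 0 := by linarith
  have e3 : 2 * β - 2 + 1 = -(1 - 2 * β) := by ring
  rw [neg_div, mul_neg, mul_div_assoc', e2, e3, div_neg, neg_neg, e1]
  field_simp
  ring

/-- A kernel dominated by a multiple of the power kernel `(s - y)_+^(β-1)`. -/
structure PowerBound (β K : ℝ) (a : ℝ → ℝ → ℝ) : Prop where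
  measurable : ∀ y, Measurable fun s => a s y
  bound : ∀ s y, |a s y| ≤ K * temperedPower (β - 1) 0 (s - y)

namespace PowerBound

variable {β K : ℝ} {a : ℝ → ℝ → ℝ}

theorem intervalIntegrable (h : PowerBound β K a) (hβ : 0 < β) (t₁ t₂ y : ℝ) :
    IntervalIntegrable (fun s => a s y) volume t₁ t₂ := by
  refine ((intervalIntegrable_power_sub hβ t₁ t₂ y).const_mul K).mono_fun
    (h.measurable y).aestronglyMeasurable (ae_of_all _ fun s => ?_)
  exact (h.bound s y).trans (le_abs_self _)

theorem abs_integral_le (h : PowerBound β K a) (hβ : 0 < β) {t₁ t₂ : ℝ} (ht : t₁ ≤ t₂) (y : ℝ) :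
    |∫ s in t₁..t₂, a s y| ≤ K * (posPower β (t₂ - y) - posPower β (t₁ - y)) := by
  rw [← integral_power_sub hβ, ← intervalIntegral.integral_const_mul]
  exact intervalIntegral.norm_integral_le_of_norm_le (f := fun s => a s y)
    (g := fun s => K * temperedPower (β - 1) 0 (s - y)) ht (ae_of_all _ fun s _ => h.bound s y)
    ((intervalIntegrable_power_sub hβ _ _ _).const_mul K)

theorem integral_sub (h : PowerBound β K a) (hβ : 0 < β) (t₁ t₂ y : ℝ) :
    (∫ s in (0 : ℝ)..t₂, a s y) - ∫ s in (0 : ℝ)..t₁, a s y = ∫ s in t₁..t₂, a s y :=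
  intervalIntegral.integral_interval_sub_left (h.intervalIntegrable hβ _ _ _)
    (h.intervalIntegrable hβ _ _ _)

theorem abs_integral_zero_le (h : PowerBound β K a) (hβ : 0 < β) (hβ1 : β ≤ 1) (hK : 0 ≤ K)
    {t : ℝ} (ht : 0 ≤ t) (y : ℝ) : |∫ s in (0 : ℝ)..t, a s y| ≤ K * (t ^ β / β) := by
  refine (h.abs_integral_le hβ ht y).trans (mul_le_mul_of_nonneg_left ?_ hK)
  have := posPower_add_sub_le hβ hβ1 ht (0 - y)
  rwa [show t + (0 - y) = t - y by ring] at this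

end PowerBound

/-- The constant depends only on `β` and `K`, so one choice serves the limiting kernel and the grid
kernels of every `n`. -/
theorem exists_lintegral_increment_le {β : ℝ} (hβ : 0 < β) (hβ1 : β < 1 / 2) (K : ℝ) :
    ∃ c : ℝ, 0 ≤ c ∧ ∀ a : ℝ → ℝ → ℝ, PowerBound β K a → ∀ t₁ t₂ : ℝ,
      ∫⁻ y, ‖(∫ s in (0 : ℝ)..t₂, a s y) - ∫ s in (0 : ℝ)..t₁, a s y‖ₑ ^ 2 ≤
        ENNReal.ofReal (c * |t₂ - t₁| ^ (1 + 2 * β)) := by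
  obtain ⟨c, hc, hbound⟩ := lintegral_posPower_increment_le hβ hβ1
  have main : ∀ a : ℝ → ℝ → ℝ, PowerBound β K a → ∀ t₁ t₂ : ℝ, t₁ ≤ t₂ →
      ∫⁻ y, ‖(∫ s in (0 : ℝ)..t₂, a s y) - ∫ s in (0 : ℝ)..t₁, a s y‖ₑ ^ 2 ≤
        ENNReal.ofReal (K ^ 2 * c * |t₂ - t₁| ^ (1 + 2 * β)) := by
    intro a ha t₁ t₂ ht
    have hpt : ∀ y, ‖(∫ s in (0 : ℝ)..t₂, a s y) - ∫ s in (0 : ℝ)..t₁, a s y‖ₑ ^ 2 ≤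
        ENNReal.ofReal (K ^ 2) *
          ENNReal.ofReal ((posPower β (t₂ - y) - posPower β (t₁ - y)) ^ 2) := by
      intro y
      rw [← ENNReal.ofReal_mul (sq_nonneg _), ← mul_pow, Real.enorm_eq_ofReal_abs,
        ← ENNReal.ofReal_pow (abs_nonneg _), ha.integral_sub hβ]
      exact ENNReal.ofReal_le_ofReal
        (pow_le_pow_left₀ (abs_nonneg _) (ha.abs_integral_le hβ ht y) 2)
    refine (lintegral_mono hpt).trans ?_
    rw [lintegral_const_mul' _ _ ENNReal.ofReal_ne_top, mul_assoc,
      ENNReal.ofReal_mul (sq_nonneg K), abs_of_nonneg (sub_nonneg.2 ht)]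
    exact mul_le_mul_right (hbound t₁ t₂ ht) _
  refine ⟨K ^ 2 * c, by positivity, fun a ha t₁ t₂ => ?_⟩
  rcases le_total t₁ t₂ with ht | ht
  · exact main a ha t₁ t₂ ht
  · rw [abs_sub_comm]
    refine le_trans (le_of_eq ?_) (main a ha t₂ t₁ ht)
    refine lintegral_congr fun y => ?_
    rw [← enorm_neg, neg_sub]

end PowerKernel

/-! ### The discretized kernels -/

section DiscreteKernel

/-- The integral over `[0,t]` of the tempered power at the grid distance of `s` and `j / n`. -/
noncomputable def gridKernel (α lam : ℝ) (n : ℕ) (t : ℝ) (j : ℤ) : ℝ :=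
  ∫ s in (0 : ℝ)..t, temperedPower (α - 1) lam (((⌈(n : ℝ) * s⌉ - j : ℤ) : ℝ) / n)

theorem memLp_two_of_lintegral {Ω : Type*} [MeasurableSpace Ω] {P : Measure Ω} {f : Ω → ℝ}
    (hf : AEStronglyMeasurable f P) (h : ∫⁻ ω, ‖f ω‖ₑ ^ 2 ∂P < ∞) : MemLp f 2 P := by
  rw [lintegral_enorm_sq_eq] at h
  exact ⟨hf, (ENNReal.pow_lt_top_iff.1 h).resolve_right two_ne_zero⟩

theorem memLp_posPower_increment {β : ℝ} (hβ : 0 < β) (hβ1 : β < 1 / 2) {a b : ℝ} (hab : a ≤ b) :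
    MemLp (fun y => posPower β (b - y) - posPower β (a - y)) 2 volume := by
  obtain ⟨c, _, h⟩ := lintegral_posPower_increment_le hβ hβ1
  have hm := measurable_posPower β
  refine memLp_two_of_lintegral (by fun_prop) (lt_of_le_of_lt (le_of_eq ?_)
    ((h a b hab).trans_lt ENNReal.ofReal_lt_top))
  refine lintegral_congr fun y => ?_
  rw [← sq_abs (_ - _), ENNReal.ofReal_pow (abs_nonneg _), ← Real.enorm_eq_ofReal_abs]

/-- A positive difference `m` of ceilings is at least one, and `n (s - y) < m + 1 ≤ 2 m`; this is
the origin of the factor `1/2`. -/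
theorem grid_pos_imp {n : ℕ} (hn : 1 ≤ n) {s y : ℝ}
    (h : 0 < ((⌈(n : ℝ) * s⌉ - ⌈(n : ℝ) * y⌉ : ℤ) : ℝ) / n) :
    0 < s - y ∧ (s - y) / 2 ≤ ((⌈(n : ℝ) * s⌉ - ⌈(n : ℝ) * y⌉ : ℤ) : ℝ) / n := by
  have hn' : (0 : ℝ) < n := by exact_mod_cast hn
  have h1 : 0 < ((⌈(n : ℝ) * s⌉ - ⌈(n : ℝ) * y⌉ : ℤ) : ℝ) := (div_pos_iff_of_pos_right hn').1 h
  have h2 : 1 ≤ ⌈(n : ℝ) * s⌉ - ⌈(n : ℝ) * y⌉ := by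
    have : 0 < ⌈(n : ℝ) * s⌉ - ⌈(n : ℝ) * y⌉ := by exact_mod_cast h1
    omega
  have h3 : (1 : ℝ) ≤ ((⌈(n : ℝ) * s⌉ - ⌈(n : ℝ) * y⌉ : ℤ) : ℝ) := by exact_mod_cast h2
  constructor
  · by_contra hle
    have : (n : ℝ) * s ≤ n * y := by
      apply mul_le_mul_of_nonneg_left _ hn'.le
      linarith
    have := Int.ceil_mono this
    omega
  · rw [le_div_iff₀ hn']
    push_cast at h3 ⊢
    linarith [Int.le_ceil ((n : ℝ) * s), Int.ceil_lt_add_one ((n : ℝ) * y)]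

theorem tendsto_grid (s y : ℝ) :
    Tendsto (fun n : ℕ => ((⌈(n : ℝ) * s⌉ - ⌈(n : ℝ) * y⌉ : ℤ) : ℝ) / n) atTop (𝓝 (s - y)) := by
  have key : ∀ x : ℝ, Tendsto (fun n : ℕ => (⌈(n : ℝ) * x⌉ : ℝ) / n) atTop (𝓝 x) := by
    intro x
    have h0 : Tendsto (fun n : ℕ => x + 1 / (n : ℝ)) atTop (𝓝 x) := by
      simpa using tendsto_one_div_atTop_nhds_zero_nat.const_add x
    refine tendsto_of_tendsto_of_tendsto_of_le_of_le' tendsto_const_nhds h0 ?_ ?_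
    · filter_upwards [eventually_ge_atTop 1] with n hn
      have hn' : (0 : ℝ) < n := by exact_mod_cast hn
      rw [le_div_iff₀ hn', mul_comm]
      exact Int.le_ceil _
    · filter_upwards [eventually_ge_atTop 1] with n hn
      have hn' : (0 : ℝ) < n := by exact_mod_cast hn
      rw [div_le_iff₀ hn', add_mul, one_div, inv_mul_cancel₀ hn'.ne', mul_comm]
      exact (Int.ceil_lt_add_one _).le
  refine ((key s).sub (key y)).congr fun n => ?_
  push_cast
  ring

/-- The only possible discontinuity is at `s = y`. For `s ≤ y` the ceilings are ordered as well, so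
the grid value is identically zero; for `s > y` the function is continuous at the limit. -/
theorem tendsto_temperedPower_grid (p lam s y : ℝ) :
    Tendsto (fun n : ℕ => temperedPower p lam (((⌈(n : ℝ) * s⌉ - ⌈(n : ℝ) * y⌉ : ℤ) : ℝ) / n)) atTop
      (𝓝 (temperedPower p lam (s - y))) := by
  rcases le_or_gt (s - y) 0 with h | h
  · rw [temperedPower_of_nonpos _ _ h]
    refine tendsto_const_nhds.congr fun n => (temperedPower_of_nonpos _ _ ?_).symm
    have h1 : (n : ℝ) * s ≤ n * y := mul_le_mul_of_nonneg_left (by linarith) n.cast_nonneg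
    have h2 : ((⌈(n : ℝ) * s⌉ - ⌈(n : ℝ) * y⌉ : ℤ) : ℝ) ≤ 0 := by
      exact_mod_cast sub_nonpos.2 (Int.ceil_mono h1)
    exact div_nonpos_of_nonpos_of_nonneg h2 n.cast_nonneg
  · have hc : ContinuousAt (temperedPower p lam) (s - y) := by
      have h1 : ContinuousAt (fun x : ℝ => x ^ p * Real.exp (-(lam * x))) (s - y) :=
        (Real.continuousAt_rpow_const _ _ (Or.inl h.ne')).mul (by fun_prop)
      refine h1.congr ?_
      filter_upwards [lt_mem_nhds h] with x hx
      rw [temperedPower, if_pos hx]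
    exact hc.tendsto.comp (tendsto_grid s y)

theorem exists_powerBound {α β lam : ℝ} (hβ : β ≤ α) (hβ1 : β ≤ 1) (hlam : 0 < lam) :
    ∃ K : ℝ, 0 ≤ K ∧ PowerBound β K (fun s y => temperedPower (α - 1) lam (s - y)) ∧
      ∀ n : ℕ, 1 ≤ n → PowerBound β K (fun s y =>
        temperedPower (α - 1) lam (((⌈(n : ℝ) * s⌉ - ⌈(n : ℝ) * y⌉ : ℤ) : ℝ) / n)) := by
  obtain ⟨K, hK, h⟩ := exists_temperedPower_le hβ hβ1 hlam
  have hm := measurable_temperedPower (α - 1) lam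
  refine ⟨K, hK, ⟨fun y => by fun_prop, fun s y => h _ _ fun hpos => ⟨hpos, by linarith⟩⟩,
    fun n hn => ⟨fun y => ?_, fun s y => h _ _ fun hpos => grid_pos_imp hn hpos⟩⟩
  refine hm.comp (Measurable.div_const ?_ _)
  have h1 : Measurable fun s : ℝ => (⌈(n : ℝ) * s⌉ - ⌈(n : ℝ) * y⌉ : ℤ) :=
    (Int.measurable_ceil.comp (measurable_const_mul (n : ℝ))).sub_const _
  exact (measurable_of_countable (fun z : ℤ => (z : ℝ))).comp h1

theorem measurable_gridKernel (α lam : ℝ) (n : ℕ) (t : ℝ) :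
    Measurable fun y : ℝ => gridKernel α lam n t ⌈(n : ℝ) * y⌉ :=
  (measurable_of_countable (gridKernel α lam n t)).comp
    (Int.measurable_ceil.comp (measurable_const_mul (n : ℝ)))

theorem tendsto_gridKernel {α lam : ℝ} (hα : 0 < α) (hlam : 0 < lam) (t y : ℝ) :
    Tendsto (fun n : ℕ => gridKernel α lam n t ⌈(n : ℝ) * y⌉) atTop
      (𝓝 (∫ s in (0 : ℝ)..t, temperedPower (α - 1) lam (s - y))) := by
  -- Only integrability in `s` over `[0,t]` matters here, so any positive exponent that is at most
  -- `α` and at most `1` will do; `β < 1/2` is needed only for integrability in `y`.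
  obtain ⟨K, hK, _, hn⟩ := exists_powerBound (α := α) (β := min α 1) (min_le_left _ _)
    (min_le_right _ _) hlam
  have hβ : 0 < min α 1 := lt_min hα one_pos
  refine intervalIntegral.tendsto_integral_filter_of_dominated_convergence
    (fun s => K * temperedPower (min α 1 - 1) 0 (s - y)) ?_ ?_
    ((intervalIntegrable_power_sub hβ _ _ _).const_mul K) ?_
  · filter_upwards [eventually_ge_atTop 1] with n h1
    exact ((hn n h1).measurable y).aestronglyMeasurable
  · filter_upwards [eventually_ge_atTop 1] with n h1
    exact ae_of_all _ fun s _ => (hn n h1).bound s y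
  · exact ae_of_all _ fun s _ => tendsto_temperedPower_grid _ _ _ _

/-- The kernel of the tempered Hermite process in terms of `α = H - 1/2`. -/
theorem kernel_eq {α H : ℝ} (hH : H = 1 / 2 + α) (lam t y : ℝ) :
    kernel H lam t y = ∫ s in (0 : ℝ)..t, temperedPower (α - 1) lam (s - y) := by
  rw [kernel, show H - 3 / 2 = α - 1 by rw [hH]; ring]

/-- The grid kernels are functions of an integer, hence measurable, and the kernel is their
pointwise limit. -/
theorem measurable_kernel {α H lam : ℝ} (hα : 0 < α) (hH : H = 1 / 2 + α) (hlam : 0 < lam)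
    (t : ℝ) : Measurable (kernel H lam t) := by
  refine measurable_of_tendsto_metrizable (fun n => measurable_gridKernel α lam n t)
    (tendsto_pi_nhds.2 fun y => ?_)
  rw [kernel_eq hH]
  exact tendsto_gridKernel hα hlam t y

theorem exists_exponent {α : ℝ} (hα : 0 < α) : ∃ β : ℝ, 0 < β ∧ β < 1 / 2 ∧ β ≤ α ∧ β ≤ 1 :=
  ⟨min α (1 / 4), lt_min hα (by norm_num), (min_le_right _ _).trans_lt (by norm_num),
    min_le_left _ _, (min_le_right _ _).trans (by norm_num)⟩

theorem memLp_kernel {α H lam : ℝ} (hα : 0 < α) (hH : H = 1 / 2 + α) (hlam : 0 < lam)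
    {t : ℝ} (ht : 0 ≤ t) : MemLp (kernel H lam t) 2 volume := by
  obtain ⟨β, hβ, hβ2, hβα, hβ1⟩ := exists_exponent hα
  obtain ⟨K, hK, hk, _⟩ := exists_powerBound hβα hβ1 hlam
  refine ((memLp_posPower_increment hβ hβ2 ht).const_mul K).mono'
    (measurable_kernel hα hH hlam t).aestronglyMeasurable (ae_of_all _ fun y => ?_)
  rw [kernel_eq hH]
  exact hk.abs_integral_le hβ ht y

/-- Dominated convergence: the common power bound yields a square integrable majorant that does not
depend on `n`. -/
theorem tendsto_integral_gridKernel_sq {α H lam : ℝ} (hα : 0 < α) (hH : H = 1 / 2 + α)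
    (hlam : 0 < lam) {ι : Type*} (I : Finset ι) (a t : ι → ℝ) (ht : ∀ i, 0 ≤ t i) :
    Tendsto (fun n : ℕ => ∫ y, (∑ i ∈ I, a i * gridKernel α lam n (t i) ⌈(n : ℝ) * y⌉) ^ 2) atTop
      (𝓝 (∫ y, (∑ i ∈ I, a i * kernel H lam (t i) y) ^ 2)) := by
  obtain ⟨β, hβ, hβ2, hβα, hβ1⟩ := exists_exponent hα
  obtain ⟨K, hK, _, hn⟩ := exists_powerBound hβα hβ1 hlam
  have hg : MemLp (fun y => ∑ i ∈ I, |a i| *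
      (K * (posPower β (t i - y) - posPower β (0 - y)))) 2 volume :=
    memLp_finsetSum _ fun i _ =>
      ((memLp_posPower_increment hβ hβ2 (ht i)).const_mul K).const_mul |a i|
  refine tendsto_integral_filter_of_dominated_convergence _ ?_ ?_ hg.integrable_sq ?_
  · refine Eventually.of_forall fun n => ?_
    have hm := fun i => measurable_gridKernel α lam n (t i)
    exact ((Finset.measurable_fun_sum _ fun i _ => (hm i).const_mul (a i)).pow_const
      2).aestronglyMeasurable
  · filter_upwards [eventually_ge_atTop 1] with n h1
    refine ae_of_all _ fun y => ?_
    rw [norm_pow]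
    refine pow_le_pow_left₀ (norm_nonneg _) ((norm_sum_le _ _).trans (Finset.sum_le_sum fun i _ =>
      ?_)) 2
    rw [norm_mul, Real.norm_eq_abs]
    exact mul_le_mul_of_nonneg_left ((hn n h1).abs_integral_le hβ (ht i) y) (abs_nonneg _)
  · refine ae_of_all _ fun y => ?_
    refine (tendsto_finsetSum _ fun i _ => Tendsto.const_mul _ ?_).pow 2
    rw [kernel_eq hH]
    exact tendsto_gridKernel hα hlam _ y

theorem lintegral_comp_ceil {n : ℕ} (hn : 1 ≤ n) (f : ℤ → ℝ≥0∞) :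
    ∫⁻ y : ℝ, f ⌈(n : ℝ) * y⌉ = ENNReal.ofReal (1 / n) * ∑' j, f j := by
  have hn' : (0 : ℝ) < n := by exact_mod_cast hn
  have hm : Measurable fun y : ℝ => ⌈(n : ℝ) * y⌉ :=
    Int.measurable_ceil.comp (measurable_const_mul (n : ℝ))
  rw [← lintegral_map (μ := volume) (measurable_of_countable f) hm, lintegral_countable',
    mul_comm, ← ENNReal.tsum_mul_right]
  congr 1
  funext j
  rw [Measure.map_apply hm (measurableSet_singleton j)]
  have e : (fun y : ℝ => ⌈(n : ℝ) * y⌉) ⁻¹' {j} = Set.Ioc (((j : ℝ) - 1) / n) (j / n) := by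
    ext y
    simp only [Set.mem_preimage, Set.mem_singleton_iff, Int.ceil_eq_iff, Set.mem_Ioc]
    rw [div_lt_iff₀ hn', le_div_iff₀ hn', mul_comm y]
  rw [e, Real.volume_Ioc]
  congr 2
  field_simp
  ring

/-- On the cell `(k/n, (k+1)/n]` the ceiling of `n s` is `k + 1`, and the part of the cell below `t`
has length `max 0 (min 1 (n t - k)) / n`. The interpolation weight of the partial sums is thus the
length of a clipped cell. -/
theorem gridKernel_eq_sum {α lam : ℝ} {n : ℕ} (hn : 1 ≤ n) {t : ℝ} (ht : 0 ≤ t) (ht1 : t ≤ 1)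
    (j : ℤ) : gridKernel α lam n t j = ∑ k ∈ Finset.range n,
      max 0 (min 1 ((n : ℝ) * t - k)) / n *
        temperedPower (α - 1) lam ((((k : ℤ) + 1 - j : ℤ) : ℝ) / n) := by
  have hn' : (0 : ℝ) < n := by exact_mod_cast hn
  have hpt : ∀ s ∈ Set.Ioc 0 t, temperedPower (α - 1) lam (((⌈(n : ℝ) * s⌉ - j : ℤ) : ℝ) / n) =
      ∑ k ∈ Finset.range n, (Set.Ioc ((k : ℝ) / n) ((k + 1) / n)).indicator
        (fun _ => temperedPower (α - 1) lam ((((k : ℤ) + 1 - j : ℤ) : ℝ) / n)) s := by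
    intro s hs
    have hmem : ∀ k : ℕ, s ∈ Set.Ioc ((k : ℝ) / n) ((k + 1) / n) ↔ ⌈(n : ℝ) * s⌉ = (k : ℤ) + 1 := by
      intro k
      rw [Int.ceil_eq_iff, Set.mem_Ioc, div_lt_iff₀ hn', le_div_iff₀ hn', mul_comm s]
      push_cast
      rw [add_sub_cancel_right]
    have hpos : 0 < ⌈(n : ℝ) * s⌉ := Int.ceil_pos.2 (mul_pos hn' hs.1)
    have hle : ⌈(n : ℝ) * s⌉ ≤ n := Int.ceil_le.2 (by
      push_cast
      exact mul_le_of_le_one_right hn'.le (hs.2.trans ht1))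
    obtain ⟨m, hm⟩ := Int.eq_ofNat_of_zero_le (show 0 ≤ ⌈(n : ℝ) * s⌉ - 1 by omega)
    have hm' : ⌈(n : ℝ) * s⌉ = (m : ℤ) + 1 := by omega
    rw [Finset.sum_eq_single_of_mem m (Finset.mem_range.2 (by omega)),
      Set.indicator_of_mem ((hmem m).2 hm'), hm']
    intro k _ hkm
    refine Set.indicator_of_notMem (fun hk => hkm ?_) _
    have := (hmem k).1 hk
    omega
  rw [gridKernel, intervalIntegral.integral_of_le ht, setIntegral_congr_fun measurableSet_Ioc hpt,
    integral_finsetSum]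
  · refine Finset.sum_congr rfl fun k _ => ?_
    rw [integral_indicator measurableSet_Ioc, Measure.restrict_restrict measurableSet_Ioc,
      setIntegral_const, smul_eq_mul, Set.Ioc_inter_Ioc, Real.volume_real_Ioc]
    congr 1
    rw [max_eq_left (by positivity : (0 : ℝ) ≤ (k : ℝ) / n)]
    rcases le_total ((k + 1) / n : ℝ) t with h | h
    · have h' : (k : ℝ) + 1 ≤ n * t := by rwa [div_le_iff₀ hn', mul_comm] at h
      rw [min_eq_left h, min_eq_left (by linarith), max_eq_right zero_le_one, ← sub_div,
        add_sub_cancel_left, max_eq_left (by positivity)]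
    · have h' : (n : ℝ) * t ≤ k + 1 := by rwa [le_div_iff₀ hn', mul_comm] at h
      rw [min_eq_right h, min_eq_right (by linarith)]
      have e : t - k / n = (n * t - k) / n := by field_simp
      rw [e]
      rcases le_total ((n : ℝ) * t - k) 0 with h0 | h0
      · rw [max_eq_left h0, zero_div, max_eq_right (div_nonpos_of_nonpos_of_nonneg h0 hn'.le)]
      · rw [max_eq_right h0, max_eq_left (div_nonneg h0 hn'.le)]
  · intro k _
    exact (integrable_const _).indicator measurableSet_Ioc

/-- The weights of the scaled partial sums with respect to the innovations `Z j`. -/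
noncomputable def weight (α H lam : ℝ) (n : ℕ) (t : ℝ) (j : ℤ) : ℝ :=
  (n : ℝ) ^ (-H) * ∑ k ∈ Finset.range n,
    max 0 (min 1 ((n : ℝ) * t - k)) * coeff α (lam / n) ((k : ℤ) + 1 - j)

theorem coeff_eq_temperedPower {α lam : ℝ} {n : ℕ} (hn : 1 ≤ n) (i : ℤ) :
    coeff α (lam / n) i =
      1 / Real.Gamma α * (n : ℝ) ^ (α - 1) * temperedPower (α - 1) lam ((i : ℝ) / n) := by
  have hn' : (0 : ℝ) < n := by exact_mod_cast hn
  by_cases hi : 1 ≤ i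
  · have hi' : (0 : ℝ) < i := by exact_mod_cast (by omega : 0 < i)
    rw [coeff, if_pos hi, temperedPower, if_pos (by positivity), Real.div_rpow hi'.le hn'.le]
    have h1 : (n : ℝ) ^ (α - 1) ≠ 0 := by positivity
    rw [show lam / n * (i : ℝ) = lam * (i / n) by ring]
    field_simp
  · have hi' : (i : ℝ) ≤ 0 := by exact_mod_cast (by omega : i ≤ 0)
    rw [coeff, if_neg hi, temperedPower_of_nonpos _ _ (div_nonpos_of_nonpos_of_nonneg hi' hn'.le),
      mul_zero]

theorem weight_eq_gridKernel {α H lam : ℝ} (hH : H = 1 / 2 + α) {n : ℕ} (hn : 1 ≤ n) {t : ℝ}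
    (ht : 0 ≤ t) (ht1 : t ≤ 1) (j : ℤ) :
    weight α H lam n t j =
      (n : ℝ) ^ (-(1 / 2) : ℝ) * (1 / Real.Gamma α) * gridKernel α lam n t j := by
  have hn' : (0 : ℝ) < n := by exact_mod_cast hn
  rw [weight, gridKernel_eq_sum hn ht ht1, Finset.mul_sum, Finset.mul_sum]
  refine Finset.sum_congr rfl fun k _ => ?_
  rw [coeff_eq_temperedPower hn]
  -- The normalization `n^(-H)`, the scaling `n^(α-1)` of the coefficients and the cell length `1/n`
  -- combine to `n^(-1/2)` because `H = 1/2 + α`.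
  have e : (n : ℝ) ^ (-(1 / 2) : ℝ) = (n : ℝ) ^ (-H) * (n : ℝ) ^ (α - 1) * n := by
    rw [← Real.rpow_add hn', ← Real.rpow_add_one hn'.ne', hH]
    congr 1; ring
  rw [e]
  field_simp

/-- Sums of squares of combinations of the weights as integrals. -/
theorem tsum_ofReal_weight_sq {α H lam : ℝ} (hH : H = 1 / 2 + α) {n : ℕ} (hn : 1 ≤ n)
    {ι : Type*} (I : Finset ι) (a t : ι → ℝ) (ht : ∀ i, 0 ≤ t i) (ht1 : ∀ i, t i ≤ 1) :
    ∑' j, ENNReal.ofReal ((∑ i ∈ I, a i * weight α H lam n (t i) j) ^ 2) =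
      ENNReal.ofReal ((1 / Real.Gamma α) ^ 2) *
        ∫⁻ y : ℝ, ‖∑ i ∈ I, a i * gridKernel α lam n (t i) ⌈(n : ℝ) * y⌉‖ₑ ^ 2 := by
  have hn' : (0 : ℝ) < n := by exact_mod_cast hn
  rw [lintegral_comp_ceil hn fun j => ‖∑ i ∈ I, a i * gridKernel α lam n (t i) j‖ₑ ^ 2,
    ← mul_assoc, ← ENNReal.tsum_mul_left]
  congr 1
  funext j
  rw [Real.enorm_eq_ofReal_abs, ← ENNReal.ofReal_pow (abs_nonneg _), sq_abs,
    ← ENNReal.ofReal_mul (by positivity), ← ENNReal.ofReal_mul (by positivity)]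
  congr 1
  have e : ∑ i ∈ I, a i * weight α H lam n (t i) j = (n : ℝ) ^ (-(1 / 2) : ℝ) *
      (1 / Real.Gamma α) * ∑ i ∈ I, a i * gridKernel α lam n (t i) j := by
    rw [Finset.mul_sum]
    refine Finset.sum_congr rfl fun i _ => ?_
    rw [weight_eq_gridKernel hH hn (ht i) (ht1 i)]
    ring
  have e2 : ((n : ℝ) ^ (-(1 / 2) : ℝ)) ^ 2 = 1 / n := by
    rw [← Real.rpow_natCast, ← Real.rpow_mul hn'.le,
      show (-(1 / 2) : ℝ) * (2 : ℕ) = -1 by norm_num, Real.rpow_neg_one, one_div]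
  rw [e, mul_pow, mul_pow, e2]
  ring

end DiscreteKernel

/-! ### The scaled partial sums -/

section PartialSums

theorem summable_coeff (α : ℝ) {μ : ℝ} (hμ : 0 < μ) : Summable (coeff α μ) := by
  refine Summable.of_nat_of_neg ?_ ?_
  · refine Summable.of_norm_bounded
      ((Real.summable_pow_mul_exp_neg_nat_mul ⌈α⌉₊ hμ).mul_left |1 / Real.Gamma α|) fun m => ?_
    by_cases hm : 1 ≤ (m : ℤ)
    · have hm1 : (1 : ℝ) ≤ m := by exact_mod_cast hm
      rw [coeff, if_pos hm, norm_mul, norm_mul, Real.norm_eq_abs, mul_assoc, Int.cast_natCast,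
        Real.norm_of_nonneg (by positivity), Real.norm_of_nonneg (Real.exp_nonneg _), neg_mul]
      gcongr
      rw [← Real.rpow_natCast]
      exact Real.rpow_le_rpow_of_exponent_le hm1 (by linarith [Nat.le_ceil α])
    · rw [coeff, if_neg hm, norm_zero]
      positivity
  · refine summable_zero.congr fun m => ?_
    rw [coeff, if_neg (by omega)]

theorem summable_coeff_sub (α : ℝ) {μ : ℝ} (hμ : 0 < μ) (k : ℤ) :
    Summable fun j => coeff α μ (k - j) :=
  (summable_coeff α hμ).comp_injective sub_right_injective

variable {α H lam : ℝ}

theorem summable_weight (hlam : 0 < lam) {n : ℕ} (hn : 1 ≤ n) (t : ℝ) :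
    Summable (weight α H lam n t) := by
  have hn' : (0 : ℝ) < n := by exact_mod_cast hn
  unfold weight
  refine Summable.mul_left _ (summable_sum fun k _ => Summable.mul_left _ ?_)
  exact summable_coeff_sub α (div_pos hlam hn') ((k : ℤ) + 1)

theorem summable_abs_sum_weight (hlam : 0 < lam) {n : ℕ} (hn : 1 ≤ n) {ι : Type*} (I : Finset ι)
    (a t : ι → ℝ) : Summable fun j => |∑ i ∈ I, a i * weight α H lam n (t i) j| :=
  (summable_sum fun i _ => (summable_weight hlam hn (t i)).mul_left (a i)).abs

theorem scaledPartialSum_eq {Ω : Type*} (Z : ℤ → Ω → ℝ) (n : ℕ) (ω : Ω) :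
    scaledPartialSum α H lam Z n ω = ∑ k ∈ Finset.range n,
      ((n : ℝ) ^ (-H) * linearProcess α (lam / n) Z ((k : ℤ) + 1) ω) • ramp n k := by
  ext t
  have h := partialSum_eq (fun k : ℕ => linearProcess α (lam / n) Z k ω) n
    (mul_nonneg n.cast_nonneg t.2.1) (mul_le_of_le_one_right n.cast_nonneg t.2.2)
  rw [ContinuousMap.sum_apply]
  change (n : ℝ) ^ (-H) * partialSum _ _ = _
  rw [h, Finset.mul_sum]
  refine Finset.sum_congr rfl fun k _ => ?_
  rw [ContinuousMap.smul_apply, ramp_apply, smul_eq_mul]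
  push_cast
  ring

theorem linearProcess_eq {Ω : Type*} (μ : ℝ) (Z : ℤ → Ω → ℝ) (k : ℤ) (ω : Ω) :
    linearProcess α μ Z k ω = ∑' j, coeff α μ (k - j) * Z j ω := by
  rw [linearProcess, ← (Equiv.subLeft k).tsum_eq]
  simp

variable {Ω : Type*} [MeasurableSpace Ω] {P : Measure Ω}

theorem ae_summable_coeff_mul {Z : ℤ → Ω → ℝ} (hident : ∀ j, IdentDistrib (Z j) (Z 0) P P)
    (hint : Integrable (Z 0) P) {μ : ℝ} (hμ : 0 < μ) (k : ℤ) :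
    ∀ᵐ ω ∂P, Summable fun j => coeff α μ (k - j) * Z j ω :=
  ae_summable_mul hident hint (summable_coeff_sub α hμ k).abs

theorem ae_summable_linearProcess {Z : ℤ → Ω → ℝ}
    (hident : ∀ j, IdentDistrib (Z j) (Z 0) P P) (hint : Integrable (Z 0) P) {μ : ℝ} (hμ : 0 < μ)
    (k : ℤ) : ∀ᵐ ω ∂P, Summable fun j => coeff α μ j * Z (k - j) ω := by
  filter_upwards [ae_summable_coeff_mul (α := α) hident hint hμ k] with ω hω
  refine ((Equiv.subLeft k).summable_iff.2 hω).congr fun j => ?_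
  simp

theorem aemeasurable_linearProcess {Z : ℤ → Ω → ℝ}
    (hident : ∀ j, IdentDistrib (Z j) (Z 0) P P) (hint : Integrable (Z 0) P) {μ : ℝ} (hμ : 0 < μ)
    (k : ℤ) : AEMeasurable (linearProcess α μ Z k) P := by
  refine aemeasurable_of_tendsto_metrizable_ae (atTop : Filter (Finset ℤ))
    (f := fun s ω => ∑ j ∈ s, coeff α μ j * Z (k - j) ω) (fun s => ?_) ?_
  · exact Finset.aemeasurable_fun_sum _ fun j _ => (hident (k - j)).aemeasurable_fst.const_mul _
  · filter_upwards [ae_summable_linearProcess (α := α) hident hint hμ k] with ω hω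
    exact hω.hasSum

theorem aemeasurable_scaledPartialSum {Z : ℤ → Ω → ℝ}
    (hident : ∀ j, IdentDistrib (Z j) (Z 0) P P) (hint : Integrable (Z 0) P) (hlam : 0 < lam)
    (n : ℕ) : AEMeasurable (scaledPartialSum α H lam Z n) P := by
  have e : scaledPartialSum α H lam Z n = fun ω => ∑ k ∈ Finset.range n,
      ((n : ℝ) ^ (-H) * linearProcess α (lam / n) Z ((k : ℤ) + 1) ω) • ramp n k :=
    funext (scaledPartialSum_eq Z n)
  rw [e]
  rcases n.eq_zero_or_pos with rfl | hn
  · simp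
  have hn' : (0 : ℝ) < n := by exact_mod_cast hn
  refine Finset.aemeasurable_fun_sum _ fun k _ => ?_
  have h := (aemeasurable_linearProcess (α := α) hident hint (div_pos hlam hn')
    ((k : ℤ) + 1)).const_mul ((n : ℝ) ^ (-H))
  exact (continuous_id.smul continuous_const : Continuous fun x : ℝ =>
    x • ramp n k).measurable.comp_aemeasurable h

/-- The scaled partial sums as weighted sums of the innovations. -/
theorem ae_scaledPartialSum_eq_tsum {Z : ℤ → Ω → ℝ}
    (hident : ∀ j, IdentDistrib (Z j) (Z 0) P P) (hint : Integrable (Z 0) P) (hlam : 0 < lam)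
    {n : ℕ} (hn : 1 ≤ n) {ι : Type*} (I : Finset ι) (a : ι → ℝ) (t : ι → unitInterval) :
    ∀ᵐ ω ∂P, ∑ i ∈ I, a i * scaledPartialSum α H lam Z n ω (t i) =
      ∑' j, (∑ i ∈ I, a i * weight α H lam n (t i) j) * Z j ω := by
  have hn' : (0 : ℝ) < n := by exact_mod_cast hn
  have h := ae_all_iff.2 fun k : ℕ =>
    ae_summable_coeff_mul (α := α) hident hint (div_pos hlam hn') ((k : ℤ) + 1)
  filter_upwards [h] with ω hω
  have h1 : ∀ s : unitInterval, HasSum (fun j => weight α H lam n s j * Z j ω)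
      (scaledPartialSum α H lam Z n ω s) := by
    intro s
    rw [scaledPartialSum_eq, ContinuousMap.sum_apply]
    have h2 : HasSum (fun j => ∑ k ∈ Finset.range n, (n : ℝ) ^ (-H) * ramp n k s *
        (coeff α (lam / n) ((k : ℤ) + 1 - j) * Z j ω))
        (∑ k ∈ Finset.range n, (n : ℝ) ^ (-H) * ramp n k s *
          linearProcess α (lam / n) Z ((k : ℤ) + 1) ω) := by
      refine hasSum_sum fun k _ => ?_
      rw [linearProcess_eq]
      exact (hω k).hasSum.mul_left _
    convert! h2 using 1
    · funext j
      rw [weight, Finset.mul_sum, Finset.sum_mul]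
      refine Finset.sum_congr rfl fun k _ => ?_
      rw [ramp_apply]
      ring
    · refine Finset.sum_congr rfl fun k _ => ?_
      rw [ContinuousMap.smul_apply, smul_eq_mul]
      ring
  have h3 : HasSum (fun j => ∑ i ∈ I, a i * (weight α H lam n (t i) j * Z j ω))
      (∑ i ∈ I, a i * scaledPartialSum α H lam Z n ω (t i)) :=
    hasSum_sum fun i _ => (h1 (t i)).mul_left (a i)
  rw [← h3.tsum_eq]
  refine tsum_congr fun j => ?_
  rw [Finset.sum_mul]
  exact Finset.sum_congr rfl fun i _ => by ring

variable [IsProbabilityMeasure P]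

/-- The second moments of the increments of the scaled partial sums are bounded uniformly. -/
theorem exists_incrementBound_scaledPartialSum {Z : ℤ → Ω → ℝ} (hindep : iIndepFun Z P)
    (hident : ∀ j, IdentDistrib (Z j) (Z 0) P P) (hL2 : MemLp (Z 0) 2 P)
    (hmean : ∫ ω, Z 0 ω ∂P = 0) {v : ℝ≥0} (hv : ∫ ω, Z 0 ω ^ 2 ∂P = v)
    (hH : H = 1 / 2 + α) (hlam : 0 < lam) {β : ℝ} (hβ : 0 < β) (hβ2 : β < 1 / 2) (hβα : β ≤ α) :
    ∃ C : ℝ, 0 ≤ C ∧ ∀ n : ℕ, 1 ≤ n →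
      IncrementBound P (fun t ω => scaledPartialSum α H lam Z n ω t) C (2 * β) := by
  obtain ⟨K, _, _, hgrid⟩ := exists_powerBound hβα (by linarith) hlam
  obtain ⟨c, hc, hinc⟩ := exists_lintegral_increment_le hβ hβ2 K
  refine ⟨v * ((1 / Real.Gamma α) ^ 2 * c), by positivity, fun n hn s t => ?_⟩
  -- An increment is the combination with coefficients `1` and `-1` of two values of the path, so
  -- the general formulas for finite combinations apply.
  let a : Fin 2 → ℝ := ![1, -1]
  let τ : Fin 2 → unitInterval := ![t, s]
  have hsum := summable_abs_sum_weight (α := α) (H := H) hlam hn Finset.univ a fun i => (τ i : ℝ)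
  have hrep : ∫⁻ ω, ‖scaledPartialSum α H lam Z n ω t - scaledPartialSum α H lam Z n ω s‖ₑ ^ 2 ∂P =
      ∫⁻ ω, ‖∑' j, (∑ i, a i * weight α H lam n (τ i) j) * Z j ω‖ₑ ^ 2 ∂P := by
    refine lintegral_congr_ae ?_
    filter_upwards [ae_scaledPartialSum_eq_tsum (α := α) (H := H) hident
      (hL2.integrable one_le_two) hlam hn Finset.univ a τ] with ω hω
    rw [← hω, Fin.sum_univ_two]
    simp [a, τ, sub_eq_add_neg]
  refine hrep.trans_le ((lintegral_tsum_mul_sq_le hindep hident hL2 hmean hv hsum).trans ?_)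
  rw [ENNReal.ofReal_mul v.coe_nonneg, mul_assoc (v : ℝ), ENNReal.ofReal_mul v.coe_nonneg]
  refine mul_le_mul_right ?_ _
  rw [ENNReal.ofReal_tsum_of_nonneg (fun _ => sq_nonneg _) (summable_sq_of_summable_abs hsum),
    tsum_ofReal_weight_sq hH hn Finset.univ a (fun i => (τ i : ℝ)) (fun i => (τ i).2.1)
      (fun i => (τ i).2.2), mul_assoc ((1 / Real.Gamma α) ^ 2), ENNReal.ofReal_mul (sq_nonneg _)]
  refine mul_le_mul_right ?_ _
  refine le_trans (le_of_eq (lintegral_congr fun y => ?_)) (hinc _ (hgrid n hn) s t)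
  rw [Fin.sum_univ_two]
  simp [a, τ, sub_eq_add_neg, gridKernel]

theorem tendsto_tsum_weight_sq (hα : 0 < α) (hH : H = 1 / 2 + α) (hlam : 0 < lam) {ι : Type*}
    (I : Finset ι) (a : ι → ℝ) (t : ι → unitInterval) :
    Tendsto (fun n : ℕ => ∑' j, (∑ i ∈ I, a i * weight α H lam n (t i) j) ^ 2) atTop
      (𝓝 ((1 / Real.Gamma α) ^ 2 * ∫ y, (∑ i ∈ I, a i * kernel H lam (t i) y) ^ 2)) := by
  refine ((tendsto_integral_gridKernel_sq hα hH hlam I a (fun i => (t i : ℝ))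
    fun i => (t i).2.1).const_mul ((1 / Real.Gamma α) ^ 2)).congr' ?_
  filter_upwards [eventually_ge_atTop 1] with n hn
  have h := congrArg ENNReal.toReal (tsum_ofReal_weight_sq (lam := lam) hH hn I a
    (fun i => (t i : ℝ)) (fun i => (t i).2.1) fun i => (t i).2.2)
  rw [ENNReal.tsum_toReal_eq fun _ => ENNReal.ofReal_ne_top, ENNReal.toReal_mul,
    ENNReal.toReal_ofReal (sq_nonneg _)] at h
  simp only [ENNReal.toReal_ofReal (sq_nonneg _)] at h
  have hm := fun i => measurable_gridKernel α lam n (t i)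
  rw [h, integral_eq_lintegral_of_nonneg_ae (ae_of_all _ fun _ => sq_nonneg _)
    ((Finset.measurable_fun_sum _ fun i _ => (hm i).const_mul (a i)).pow_const
      2).aestronglyMeasurable]
  congr 2
  refine lintegral_congr fun y => ?_
  rw [← sq_abs, ENNReal.ofReal_pow (abs_nonneg _), ← Real.enorm_eq_ofReal_abs]

/-- The grid kernels are bounded by `K t^β / β` uniformly in `j` and `n`, so the weights are
`O(n^(-1/2))`: no single innovation matters in the limit. -/
theorem eventually_abs_sum_weight_lt (hα : 0 < α) (hH : H = 1 / 2 + α) (hlam : 0 < lam)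
    {ι : Type*} (I : Finset ι) (a : ι → ℝ) (t : ι → unitInterval) {δ : ℝ} (hδ : 0 < δ) :
    ∀ᶠ n : ℕ in atTop, ∀ j, |∑ i ∈ I, a i * weight α H lam n (t i) j| < δ := by
  obtain ⟨β, hβ, _, hβα, hβ1⟩ := exists_exponent hα
  obtain ⟨K, hK, _, hgrid⟩ := exists_powerBound hβα hβ1 hlam
  have hlim : Tendsto (fun n : ℕ => (n : ℝ) ^ (-(1 / 2) : ℝ) *
      ∑ i ∈ I, |a i| * (|1 / Real.Gamma α| * (K * ((t i : ℝ) ^ β / β)))) atTop (𝓝 0) := by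
    have h := ((tendsto_rpow_neg_atTop (by norm_num : (0 : ℝ) < 1 / 2)).comp
      tendsto_natCast_atTop_atTop).mul_const
        (∑ i ∈ I, |a i| * (|1 / Real.Gamma α| * (K * ((t i : ℝ) ^ β / β))))
    rwa [zero_mul] at h
  filter_upwards [eventually_ge_atTop 1, hlim.eventually_lt_const hδ] with n hn hlt j
  have hn' : (0 : ℝ) < n := by exact_mod_cast hn
  refine lt_of_le_of_lt ?_ hlt
  refine (Finset.abs_sum_le_sum_abs _ _).trans ?_
  rw [Finset.mul_sum]
  refine Finset.sum_le_sum fun i _ => ?_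
  have hg : |gridKernel α lam n (t i) j| ≤ K * ((t i : ℝ) ^ β / β) := by
    -- The bound is stated for real base points; `y = j / n` has `⌈n y⌉ = j`.
    have h := (hgrid n hn).abs_integral_zero_le hβ hβ1 hK (t i).2.1 ((j : ℝ) / n)
    have e : (n : ℝ) * (j / n) = j := by field_simp
    simp only [e, Int.ceil_intCast] at h
    exact h
  rw [weight_eq_gridKernel hH hn (t i).2.1 (t i).2.2, abs_mul, abs_mul, abs_mul,
    abs_of_nonneg (by positivity : (0 : ℝ) ≤ (n : ℝ) ^ (-(1 / 2) : ℝ))]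
  calc |a i| * ((n : ℝ) ^ (-(1 / 2) : ℝ) * |1 / Real.Gamma α| * |gridKernel α lam n (t i) j|)
      = (n : ℝ) ^ (-(1 / 2) : ℝ) * (|a i| * (|1 / Real.Gamma α| * |gridKernel α lam n (t i) j|)) := by
        ring
    _ ≤ _ := by gcongr

/-- Convergence of the finite-dimensional characteristic functions of the scaled partial sums. -/
theorem tendsto_integral_exp_scaledPartialSum {Z : ℤ → Ω → ℝ} (hindep : iIndepFun Z P)
    (hident : ∀ j, IdentDistrib (Z j) (Z 0) P P) (hL2 : MemLp (Z 0) 2 P)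
    (hmean : ∫ ω, Z 0 ω ∂P = 0) {v : ℝ≥0} (hv : ∫ ω, Z 0 ω ^ 2 ∂P = v)
    (hα : 0 < α) (hH : H = 1 / 2 + α) (hlam : 0 < lam) {ι : Type*} (I : Finset ι) (a : ι → ℝ)
    (t : ι → unitInterval) :
    Tendsto (fun n => ∫ ω, Complex.exp
      (((∑ i ∈ I, a i * scaledPartialSum α H lam Z n ω (t i) : ℝ) : ℂ) * Complex.I) ∂P) atTop
      (𝓝 (Complex.exp ((-(v * ((1 / Real.Gamma α) ^ 2 *
        ∫ y, (∑ i ∈ I, a i * kernel H lam (t i) y) ^ 2) / 2) : ℝ) : ℂ))) := by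
  set σ := (1 / Real.Gamma α) ^ 2 * ∫ y, (∑ i ∈ I, a i * kernel H lam (t i) y) ^ 2
  have hσ : 0 ≤ σ := mul_nonneg (sq_nonneg _) (integral_nonneg fun _ => sq_nonneg _)
  have hlim := tendsto_tsum_weight_sq hα hH hlam I a t
  have hexp : Tendsto (fun n : ℕ => Complex.exp
      ((-(v * (∑' j, (∑ i ∈ I, a i * weight α H lam n (t i) j) ^ 2) / 2) : ℝ) : ℂ)) atTop
      (𝓝 (Complex.exp ((-(v * σ / 2) : ℝ) : ℂ))) :=
    ((by fun_prop : Continuous fun x : ℝ =>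
      Complex.exp ((-(v * x / 2) : ℝ) : ℂ)).tendsto _).comp hlim
  refine tendsto_of_tendsto_of_dist hexp ?_
  rw [Metric.tendsto_nhds]
  intro ε hε
  -- The sum of squared weights tends to `σ`, hence is eventually below `σ + 1`; this tolerance then
  -- makes the error at most `ε / 2`, with `σ + 1` also covering `σ = 0`.
  obtain ⟨δ, hδ, hclose⟩ := norm_integral_exp_tsum_sub_le hindep hident hL2 hmean hv
    (show 0 < ε / (2 * (σ + 1)) by positivity)
  filter_upwards [eventually_ge_atTop 1, eventually_abs_sum_weight_lt hα hH hlam I a t hδ,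
    hlim.eventually_lt_const (show σ < σ + 1 by linarith)] with n hn hsmall hlt
  have h := hclose _ (summable_abs_sum_weight (α := α) (H := H) hlam hn I a fun i => (t i : ℝ))
    hsmall
  have hrep : ∫ ω, Complex.exp
      (((∑ i ∈ I, a i * scaledPartialSum α H lam Z n ω (t i) : ℝ) : ℂ) * Complex.I) ∂P =
      ∫ ω, Complex.exp (((∑' j, (∑ i ∈ I, a i * weight α H lam n (t i) j) * Z j ω : ℝ) : ℂ) *
        Complex.I) ∂P := by
    refine integral_congr_ae ?_
    filter_upwards [ae_scaledPartialSum_eq_tsum (α := α) (H := H) hident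
      (hL2.integrable one_le_two) hlam hn I a t] with ω hω
    rw [hω]
  rw [hrep, Real.dist_eq, sub_zero, abs_of_nonneg dist_nonneg, dist_comm, dist_eq_norm]
  refine lt_of_le_of_lt h ?_
  have h0 : 0 ≤ ∑' j, (∑ i ∈ I, a i * weight α H lam n (t i) j) ^ 2 :=
    tsum_nonneg fun _ => sq_nonneg _
  calc ε / (2 * (σ + 1)) * ∑' j, (∑ i ∈ I, a i * weight α H lam n (t i) j) ^ 2
      ≤ ε / (2 * (σ + 1)) * (σ + 1) := by gcongr
    _ = ε / 2 := by field_simp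
    _ < ε := by linarith

end PartialSums

/-! ### The tempered Hermite process -/

section Limit

variable {Ω : Type*} [MeasurableSpace Ω] {P : Measure Ω} {B : Set ℝ → Ω → ℝ} {v : ℝ≥0}

theorem IncrementBound.mono {x : unitInterval → Ω → ℝ} {K K' γ : ℝ} (h : IncrementBound P x K γ)
    (hK : K ≤ K') : IncrementBound P x K' γ := fun s t =>
  (h s t).trans (ENNReal.ofReal_le_ofReal (by gcongr))

theorem IncrementBound.const_mul {x : unitInterval → Ω → ℝ} {K γ : ℝ} (h : IncrementBound P x K γ)
    (c : ℝ) : IncrementBound P (fun t ω => c * x t ω) (c ^ 2 * K) γ := by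
  intro s t
  have e : ∀ ω, ‖c * x t ω - c * x s ω‖ₑ ^ 2 = ENNReal.ofReal (c ^ 2) * ‖x t ω - x s ω‖ₑ ^ 2 := by
    intro ω
    rw [← mul_sub, enorm_mul, mul_pow, Real.enorm_eq_ofReal_abs c,
      ← ENNReal.ofReal_pow (abs_nonneg _), sq_abs]
  simp only [e]
  rw [lintegral_const_mul' _ _ ENNReal.ofReal_ne_top, mul_assoc, ENNReal.ofReal_mul (sq_nonneg _)]
  exact mul_le_mul_right (h s t) _

theorem IsWienerIntegral.congr_ae {f : ℝ → ℝ} {X Y : Ω → ℝ} (h : IsWienerIntegral B P f X)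
    (hXY : X =ᵐ[P] Y) : IsWienerIntegral B P f Y := by
  obtain ⟨hf, hX, φ, hφ, hφf, hφX⟩ := h
  refine ⟨hf, hX.ae_eq hXY, φ, hφ, hφf, hφX.congr fun m => eLpNorm_congr_ae ?_⟩
  filter_upwards [hXY] with ω hω
  rw [hω]

/-- The tempered Hermite process of order one has a continuous version, whose increments are
controlled in mean square. -/
theorem exists_isTemperedHermite [IsProbabilityMeasure P] (hB : IsGaussianRandomMeasure B v P)
    {α H lam : ℝ} (hα : 0 < α) (hH : H = 1 / 2 + α) (hlam : 0 < lam) {β : ℝ} (hβ : 0 < β)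
    (hβ2 : β < 1 / 2) (hβα : β ≤ α) :
    ∃ ζ : Ω → C(unitInterval, ℝ), IsTemperedHermite B P H lam ζ ∧
      ∃ K : ℝ, 0 ≤ K ∧ IncrementBound P (fun t ω => ζ ω t) K (2 * β) := by
  obtain ⟨K, _, hker, _⟩ := exists_powerBound hβα (by linarith) hlam
  obtain ⟨c, hc, hinc⟩ := exists_lintegral_increment_le hβ hβ2 K
  choose X hX using fun t : unitInterval =>
    hB.exists_isWienerIntegral (memLp_kernel hα hH hlam t.2.1)
  have hb : IncrementBound P X (v * c) (2 * β) := by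
    intro s t
    -- By linearity the increment is the Wiener integral of the difference of two kernels, and the
    -- isometry reduces its second moment to the `L²` bound for kernel increments.
    have h := hB.isWienerIntegral_add (hX t) (hB.isWienerIntegral_const_mul (-1) (hX s))
    have h1 := hB.lintegral_wienerIntegral_sq h
    rw [ENNReal.ofReal_mul v.coe_nonneg, ← lintegral_sq_eq_ofReal h.1] at h1
    have e : ∀ ω, X t ω - X s ω = X t ω + -1 * X s ω := fun ω => by ring
    simp only [e]
    rw [h1, mul_assoc, ENNReal.ofReal_mul v.coe_nonneg]
    refine mul_le_mul_right (le_trans (le_of_eq (lintegral_congr fun y => ?_))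
      (hinc _ hker s t)) _
    rw [kernel_eq hH, kernel_eq hH, neg_one_mul, ← sub_eq_add_neg]
  obtain ⟨ζ, hζ, hζX⟩ := exists_continuous_version (fun t => (hX t).2.1)
    (mul_nonneg v.coe_nonneg hc) (by positivity) hb
  refine ⟨ζ, ⟨hζ, fun t => (hX t).congr_ae (hζX t).symm⟩, v * c, mul_nonneg v.coe_nonneg hc,
    fun s t => ?_⟩
  refine le_trans (le_of_eq (lintegral_congr_ae ?_)) (hb s t)
  filter_upwards [hζX s, hζX t] with ω h1 h2
  rw [h1, h2]

theorem integral_exp_temperedHermite [IsProbabilityMeasure P] (hB : IsGaussianRandomMeasure B v P)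
    {H lam : ℝ} {ζ : Ω → C(unitInterval, ℝ)} (hζ : IsTemperedHermite B P H lam ζ) (c : ℝ)
    {ι : Type*} (I : Finset ι) (a : ι → ℝ) (t : ι → unitInterval) :
    ∫ ω, Complex.exp (((∑ i ∈ I, a i * (c • ζ ω) (t i) : ℝ) : ℂ) * Complex.I) ∂P =
      Complex.exp ((-(v * (c ^ 2 * ∫ y, (∑ i ∈ I, a i * kernel H lam (t i) y) ^ 2) / 2) : ℝ) :
        ℂ) := by
  have h := hB.integral_exp_wienerIntegral (hB.isWienerIntegral_const_mul c
    (hB.isWienerIntegral_finsetSum I a fun i => hζ.2 (t i)))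
  simp only [mul_pow, integral_const_mul] at h
  rw [← h]
  congr 1
  funext ω
  congr 3
  rw [Finset.mul_sum]
  refine Finset.sum_congr rfl fun i _ => ?_
  rw [ContinuousMap.smul_apply, smul_eq_mul]
  ring

end Limit

end TemperedHermite

/-! ### The limit theorem -/

theorem theorem5p3 {Ω Ω' : Type*} [MeasurableSpace Ω] [MeasurableSpace Ω']
    (P : Measure Ω) [IsProbabilityMeasure P] (P' : Measure Ω') [IsProbabilityMeasure P']
    (α H lam : ℝ) (hα : 0 < α) (hH : H = 1 / 2 + α) (hlam : 0 < lam)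
    (Z : ℤ → Ω → ℝ) (hindep : iIndepFun Z P) (hident : ∀ j, IdentDistrib (Z j) (Z 0) P P)
    (hL2 : MemLp (Z 0) 2 P) (hmean : ∫ ω, Z 0 ω ∂P = 0)
    (v : ℝ≥0) (hv : ∫ ω, Z 0 ω ^ 2 ∂P = v)
    (B : Set ℝ → Ω' → ℝ) (hB : TemperedHermite.IsGaussianRandomMeasure B v P') :
    -- the series that define the linear processes converge absolutely, almost surely
    (∀ n : ℕ, 1 ≤ n → ∀ k : ℤ, ∀ᵐ ω ∂P,
      Summable (fun j : ℤ => TemperedHermite.coeff α (lam / n) j * Z (k - j) ω)) ∧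
    -- weak convergence in `C[0,1]` to the tempered Hermite process, normalized by `1 / Γ(α)`
    (∃ ζ : Ω' → C(unitInterval, ℝ), TemperedHermite.IsTemperedHermite B P' H lam ζ ∧
      TendstoInDistribution (fun (n : ℕ) (ω : Ω) => TemperedHermite.scaledPartialSum α H lam Z n ω)
        atTop (fun ω => (1 / Real.Gamma α) • ζ ω) (fun _ => P) P') ∧
    -- the bound on the second moments of the increments
    (H < 1 → ∃ C : ℝ, ∀ n : ℕ, 1 ≤ n → ∀ t₁ t₂ : unitInterval,
      ∫⁻ ω, ‖TemperedHermite.scaledPartialSum α H lam Z n ω t₂ -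
          TemperedHermite.scaledPartialSum α H lam Z n ω t₁‖ₑ ^ 2 ∂P ≤
        ENNReal.ofReal (C * |(t₂ : ℝ) - t₁| ^ (2 * H))) := by
  have hint : Integrable (Z 0) P := hL2.integrable one_le_two
  refine ⟨fun n hn k => ?_, ?_, fun hH1 => ?_⟩
  · have hn' : (0 : ℝ) < n := by exact_mod_cast hn
    exact TemperedHermite.ae_summable_linearProcess hident hint (div_pos hlam hn') k
  -- For weak convergence any `β > 0` suffices, so a small exponent is taken and no upper bound on
  -- `H` is required. The larger of the two moment constants, the limit's rescaled by `(1/Γ(α))²`,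
  -- serves both the approximations and the limit.
  · obtain ⟨β, hβ, hβ2, hβα, _⟩ := TemperedHermite.exists_exponent hα
    obtain ⟨ζ, hζ, K, hK, hζb⟩ :=
      TemperedHermite.exists_isTemperedHermite hB hα hH hlam hβ hβ2 hβα
    obtain ⟨C, hC, hSb⟩ := TemperedHermite.exists_incrementBound_scaledPartialSum hindep hident
      hL2 hmean hv hH hlam hβ hβ2 hβα
    refine ⟨ζ, hζ, TemperedHermite.tendstoInDistribution_of_charFun
      (K := max C ((1 / Real.Gamma α) ^ 2 * K)) (γ := 2 * β)
      (TemperedHermite.aemeasurable_scaledPartialSum hident hint hlam)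
      ((continuous_const_smul (1 / Real.Gamma α)).measurable.comp_aemeasurable hζ.1)
      (le_max_of_le_left hC) (by positivity) ?_ ((hζb.const_mul _).mono (le_max_right _ _))
      fun N a t => ?_⟩
    · filter_upwards [eventually_ge_atTop 1] with n hn
      exact (hSb n hn).mono (le_max_left _ _)
    · rw [TemperedHermite.integral_exp_temperedHermite hB hζ]
      exact TemperedHermite.tendsto_integral_exp_scaledPartialSum hindep hident hL2 hmean hv hα hH
        hlam _ a t
  -- Here `H < 1` means `α < 1/2`, so `β = α` is admissible and the exponent `1 + 2α` equals `2H`.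
  · obtain ⟨C, _, hC⟩ := TemperedHermite.exists_incrementBound_scaledPartialSum hindep hident
      hL2 hmean hv hH hlam hα (by linarith) le_rfl
    refine ⟨C, fun n hn t₁ t₂ => ?_⟩
    have h := hC n hn t₁ t₂
    rwa [show 1 + 2 * α = 2 * H by rw [hH]; ring] at h
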